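/- **Setting.** Let $d\ge 0$, $k\ge 1$, $\mathbb T^d=(\mathbb R/\mathbb Z)^d$. For functions $f_\iota$ on $\mathbb T^d$, $\iota\in\{0,1\}^k$, put $$\Delta^k(\boldsymbol f)(x;u_1,\dots,u_k)=\prod_{\iota\in\{0,1\}^k}\mathcal C^{|\iota|}f_\iota(x-\iota_1u_1-\dots-\iota_ku_k)\qquad(\mathcal C=\text{complex conjugation}),$$ so that $\Delta^k(\boldsymbol f)(x;u)=\Delta^{k-1}(\boldsymbol f_0)(x;u')\,\overline{\Delta^{k-1}(\boldsymbol f_1)(x-u_k;u')}$, where $\boldsymbol f_i$ is the half of the family with $\iota_k=i$ and $u'=(u_1,\dots,u_{k-1})$. For finite complex measures $\boldsymbol\mu=(\mu_\iota)$ on $\mathbb T^d$, $\Delta^k(\boldsymbol\mu)$ is the finite complex measure on $\mathbb T^d\times(\mathbb T^d)^k$ that is the weak limit of the densities $\Delta^k((K_n*\mu_\iota)_\iota)$ for every approximate identity $(K_n)$ (continuous, $K_n\ge0$, $\int K_n=1$, mass concentrating at $0$). Write $\Delta^k\mu$ when all $\mu_\iota=\mu$, let $\|\mu\|_{U^k}=\Delta^k\mu(\mathbb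 T^d\times(\mathbb T^d)^k)^{1/2^k}$ ($=\infty$ if $\Delta^k\mu$ does not exist), and let $U^k$ be the set of finite $\mu$ with $\||\mu|\|_{U^k}<\infty$. Let $(\phi_n)$ be an approximate identity of trigonometric polynomials with $0\le\widehat{\phi_n}\le1$, and $\phi_N^c=\delta_0-\phi_N$. For $1\le j\le k$ let $\phi_N^c\star_j$ denote convolution in the variable $u_j$ if $j<k$, and in the variable $x$ if $j=k$, for functions of $(x;u_1,\dots,u_{k-1})$. Define $\Delta^k_{s_j-\eta_j>N,\,s_j>N}(\boldsymbol\mu)$ as the same weak limit with $\Delta^k$ replaced by $$(\phi_N^c\star_j\Delta^{k-1}(\boldsymbol f_0))(x;u')\,\overline{(\phi_N^c\star_j\Delta^{k-1}(\boldsymbol f_1))(x-u_k;u')},$$ and $\Delta^k_{s_j-\eta_j>N}(\boldsymbol\mu)$ as the one with $$\Delta^{k-1}(\boldsymbol f_0)(x;u')\,\overline{(\phi_N^c\star_j\Delta^{k-1}(\boldsymbol f_1))(x-u_k;u')}.$$ **Lemma.** Let $\mu_\iota\in U^k$ for $\iota\in\{0,1\}^k$, $N\in\mathbb N$ and $1\le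 j\le k$. Then, in $[0,\infty]$, $$\sum_{\boldsymbol\eta\in(\mathbb Z^d)^k}\bigl|\widehat{\Delta^k_{s_j-\eta_j>N,\,s_j>N}(\boldsymbol\mu)}(0;\boldsymbol\eta)\bigr|^2\le16\prod_{\iota\in\{0,1\}^k}\|\mu_\iota\|_{U^{k+1}}^2,$$ $$\sum_{\boldsymbol\eta\in(\mathbb Z^d)^k}\bigl|\widehat{\Delta^k_{s_j-\eta_j>N}(\boldsymbol\mu)}(0;\boldsymbol\eta)\bigr|^2\le2\prod_{\iota\in\{0,1\}^k}\|\mu_\iota\|_{U^{k+1}}^2.$$ -/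

import Mathlib

open MeasureTheory Filter Topology
open scoped ENNReal ComplexConjugate

noncomputable section

namespace GowersSingular

/-- The torus `𝕋^d = (ℝ/ℤ)^d`; its `volume` is the Haar probability measure. -/
abbrev Torus (d : ℕ) : Type := UnitAddTorus (Fin d)

/-- The space `𝕋^d × (𝕋^d)^k` of points `(x; u) = (x; u_1, …, u_k)`. -/
abbrev Cube (d k : ℕ) : Type := Torus d × (Fin k → Torus d)

/-- The total variation of a complex measure is finite. -/
instance isFiniteMeasure_variation {X : Type*} [MeasurableSpace X] (μ : ComplexMeasure X) :
    IsFiniteMeasure μ.variation := by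
  have h : μ.variation ≤ (ComplexMeasure.re μ).totalVariation
      + (ComplexMeasure.im μ).totalVariation := by
    apply VectorMeasure.variation_le_of_forall_enorm_le
    intro s _
    have h1 : μ s = ((ComplexMeasure.re μ s : ℝ) : ℂ) + ((ComplexMeasure.im μ s : ℝ) : ℂ) *
        Complex.I := (Complex.re_add_im (μ s)).symm
    calc ‖μ s‖ₑ ≤ ‖((ComplexMeasure.re μ s : ℝ) : ℂ)‖ₑ
          + ‖((ComplexMeasure.im μ s : ℝ) : ℂ) * Complex.I‖ₑ := by
            rw [h1]; exact enorm_add_le _ _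
      _ = ‖ComplexMeasure.re μ s‖ₑ + ‖ComplexMeasure.im μ s‖ₑ := by
            simp [← ofReal_norm]
      _ ≤ _ := by
            rw [Measure.add_apply]
            exact add_le_add (SignedMeasure.enorm_le_totalVariation _ _)
              (SignedMeasure.enorm_le_totalVariation _ _)
  exact isFiniteMeasure_of_le _ h

/-- The integral `∫ f dμ` of a complex function against a complex measure. -/
def cintegral {X : Type*} [MeasurableSpace X] (μ : ComplexMeasure X) (f : X → ℂ) : ℂ :=
  μ.integral f (ContinuousLinearMap.mul ℝ ℂ)

/-- The total variation `|μ|`, again as a complex measure. -/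
def absMeasure {X : Type*} [MeasurableSpace X] (μ : ComplexMeasure X) : ComplexMeasure X :=
  μ.variation.toSignedMeasure.toComplexMeasure 0

/-- Fourier coefficients of a complex measure on `𝕋^d × (𝕋^d)^k`:
`∫ e^{-2πi (ξ·x + η_1·u_1 + ⋯ + η_k·u_k)} dD(x; u)`. -/
def fourierCoeffMeasure {d k : ℕ} (D : ComplexMeasure (Cube d k))
    (ξ : Fin d → ℤ) (η : Fin k → Fin d → ℤ) : ℂ :=
  cintegral D fun p =>
    UnitAddTorus.mFourier (-ξ) p.1 * ∏ i, UnitAddTorus.mFourier (-(η i)) (p.2 i)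

/-- Fourier coefficients of a kernel on the torus. -/
def kernelCoeff {d : ℕ} (φ : C(Torus d, ℝ)) (c : Fin d → ℤ) : ℂ :=
  ∫ x, UnitAddTorus.mFourier (-c) x * (φ x : ℂ)

/-- Approximate identities on the torus. -/
structure IsApproxIdentity {d : ℕ} (K : ℕ → C(Torus d, ℝ)) : Prop where
  nonneg : ∀ n x, 0 ≤ K n x
  integral_eq_one : ∀ n, ∫ x, K n x = 1
  concentrates : ∀ U ∈ 𝓝 (0 : Torus d), Tendsto (fun n => ∫ x in Uᶜ, K n x) atTop (𝓝 0)

/-- The approximate identities used for frequency truncation: each `φ_n` is a trigonometric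
polynomial, and its Fourier transform is a cutoff with values in `[0, 1]`. -/
structure IsFrequencyCutoff {d : ℕ} (φ : ℕ → C(Torus d, ℝ)) : Prop
    extends IsApproxIdentity φ where
  finite_support : ∀ n, {c | kernelCoeff (φ n) c ≠ 0}.Finite
  coeff_mem : ∀ n c, ∃ r ∈ Set.Icc (0 : ℝ) 1, kernelCoeff (φ n) c = r

/-- The convolution `K ∗ μ`. -/
def mollify {d : ℕ} (K : C(Torus d, ℝ)) (μ : ComplexMeasure (Torus d)) : Torus d → ℂ :=
  fun x => cintegral μ fun y => (K (x - y) : ℂ)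

/-- For functions `A`, `B` of `(x; u_1, …, u_k)`, the function
`A(x; u_1, …, u_k) * conj (B(x - u_{k+1}; u_1, …, u_k))` of `(x; u_1, …, u_{k+1})`. -/
def cross {d k : ℕ} (A B : Cube d k → ℂ) : Cube d (k + 1) → ℂ :=
  fun p => A (p.1, Fin.init p.2) * conj (B (p.1 - p.2 (Fin.last k), Fin.init p.2))

/-- The half `(f_{ι' i})_{ι'}` of a family indexed by `{0,1}^{k+1}`, for `i` a value of the
coordinate of the index that belongs to `u_{k+1}`. -/
def half {k : ℕ} {α : Type*} (f : (Fin (k + 1) → Bool) → α) (i : Bool) : (Fin k → Bool) → α :=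
  fun ι => f (Fin.snoc ι i)

/-- `Δ^k` of a family of functions: `∏_ι 𝒞^{|ι|} f_ι (x - ι·u)`, where `𝒞` is complex
conjugation, written through `Δ^{k+1} f = cross (Δ^k f_0) (Δ^k f_1)`. -/
def deltaFun {d : ℕ} : (k : ℕ) → ((Fin k → Bool) → Torus d → ℂ) → Cube d k → ℂ
  | 0, f => fun p => f Fin.elim0 p.1
  | k + 1, f => cross (deltaFun k (half f false)) (deltaFun k (half f true))

/-- Convolution with `φ` in the variable `u_j` when `j ≤ k`, and in the variable `x` for the
last index `j = k + 1`. -/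
def partialConv {d k : ℕ} (φ : C(Torus d, ℝ)) (j : Fin (k + 1)) (G : Cube d k → ℂ) :
    Cube d k → ℂ :=
  Fin.lastCases (motive := fun _ => Cube d k → ℂ)
    (fun p => ∫ y, (φ y : ℂ) * G (p.1 - y, p.2))
    (fun i p => ∫ y, (φ y : ℂ) * G (p.1, Function.update p.2 i (p.2 i - y)))
    j

/-- Partial convolution with `φ^c = δ_0 - φ`, whose Fourier transform is `1 - φ̂`. -/
def highPass {d k : ℕ} (φ : C(Torus d, ℝ)) (j : Fin (k + 1)) (G : Cube d k → ℂ) :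
    Cube d k → ℂ :=
  fun p => G p - partialConv φ j G p

/-- `Δ^{k+1}_{s_j - η_j > N, s_j > N}` of a family of functions, with `φ = φ_N`. -/
def deltaFunHighBoth {d k : ℕ} (φ : C(Torus d, ℝ)) (j : Fin (k + 1))
    (f : (Fin (k + 1) → Bool) → Torus d → ℂ) : Cube d (k + 1) → ℂ :=
  cross (highPass φ j (deltaFun k (half f false))) (highPass φ j (deltaFun k (half f true)))

/-- `Δ^{k+1}_{s_j - η_j > N}` of a family of functions, with `φ = φ_N`. -/
def deltaFunHighRight {d k : ℕ} (φ : C(Torus d, ℝ)) (j : Fin (k + 1))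
    (f : (Fin (k + 1) → Bool) → Torus d → ℂ) : Cube d (k + 1) → ℂ :=
  cross (deltaFun k (half f false)) (highPass φ j (deltaFun k (half f true)))

/-- `D` is the value of the operation `G` on functions at a family `μ` of complex measures: for
every approximate identity `K_n`, the measures with density `G ((K_n ∗ μ_ι)_ι)` converge weakly
to `D`. -/
def IsWeakValue {d k : ℕ} (G : ((Fin k → Bool) → Torus d → ℂ) → Cube d k → ℂ)
    (μ : (Fin k → Bool) → ComplexMeasure (Torus d)) (D : ComplexMeasure (Cube d k)) : Prop :=
  ∀ K : ℕ → C(Torus d, ℝ), IsApproxIdentity K → ∀ F : C(Cube d k, ℂ),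
    Tendsto (fun n => ∫ p, F p * G (fun ι => mollify (K n) (μ ι)) p) atTop
      (𝓝 (cintegral D F))

open Classical in
/-- The measure determined by `IsWeakValue` (and `0` where there is none). -/
def weakValue {d k : ℕ} (G : ((Fin k → Bool) → Torus d → ℂ) → Cube d k → ℂ)
    (μ : (Fin k → Bool) → ComplexMeasure (Torus d)) : ComplexMeasure (Cube d k) :=
  if h : ∃ D, IsWeakValue G μ D then h.choose else 0

/-- The measure `Δ^{k+1}_{s_j - η_j > N, s_j > N}(μ)`, where `φ = φ_N`. -/
def deltaHighBoth {d k : ℕ} (φ : C(Torus d, ℝ)) (j : Fin (k + 1))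
    (μ : (Fin (k + 1) → Bool) → ComplexMeasure (Torus d)) : ComplexMeasure (Cube d (k + 1)) :=
  weakValue (deltaFunHighBoth φ j) μ

/-- The measure `Δ^{k+1}_{s_j - η_j > N}(μ)`, where `φ = φ_N`. -/
def deltaHighRight {d k : ℕ} (φ : C(Torus d, ℝ)) (j : Fin (k + 1))
    (μ : (Fin (k + 1) → Bool) → ComplexMeasure (Torus d)) : ComplexMeasure (Cube d (k + 1)) :=
  weakValue (deltaFunHighRight φ j) μ

open Classical in
/-- The uniformity norm `‖μ‖_{U^k} = Δ^kμ(𝕋^d × (𝕋^d)^k)^{1/2^k}`, where `Δ^kμ` is `Δ^k` of the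
constant family `μ`; it is infinite when `Δ^kμ` does not exist. -/
def uNorm {d : ℕ} (k : ℕ) (μ : ComplexMeasure (Torus d)) : ℝ≥0∞ :=
  if ∃ D, IsWeakValue (deltaFun k) (fun _ => μ) D then
    ‖weakValue (deltaFun k) (fun _ => μ) Set.univ‖ₑ ^ ((1 : ℝ) / 2 ^ k)
  else ⊤

/-- The space `U^k` of complex measures `μ` with `‖|μ|‖_{U^k} < ∞`. -/
def MemU {d : ℕ} (k : ℕ) (μ : ComplexMeasure (Torus d)) : Prop :=
  uNorm k (absMeasure μ) < ⊤

end GowersSingular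

end

namespace GowersSingular

/-! Both bounds are first proved for bounded functions, where the truncated product is `cross A B`,
with `A` and `B` the possibly high-passed `Δ^k` of the two halves. Integrating out `x` turns `cross
A B`, for fixed `u'`, into the correlation of `A(·, u')` and `B(·, u')` in the last variable. Bessel
in all `u` variables and Parseval in the last one bound the sum by `energy A B`
(`tsum_fourier_cross_le`), and Cauchy–Schwarz separates `A` from `B` (`energy_le`).

The self-energy is `∑_c ∫ |Â(c; u)|⁴ du`. High-passing in `x` multiplies `Â(c; u)` by `1 - φ̂(c)`,
which lies in `[0, 1]`. High-passing in `u_j` convolves `u ↦ Â(c; u)` with `δ_0 - φ`, an operator of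
norm at most `1` on `L²` and at most `2` on `L^∞`, hence at most `√2` on `L⁴` by complex
interpolation (`IsCutoffKernel.lintegral_pow_four_le`). So an energy grows by a factor of at most
`4`, and after the square root each truncated factor costs `2`. The self-energy of an untruncated
`Δ^k` is a Gowers inner product of order `k + 2` in which every function occurs four times, so
`gowers_cauchy_schwarz` bounds it by uniformity norms (`energy_deltaFun_self_le`).

For measures, mollify by the `φ_n` themselves: the mollified measures are trigonometric polynomials,
finite partial sums pass to the limit, and the right side converges when all norms are finite. If
some norm is `0`, that measure mollifies to `0`, so the left side vanishes even when another norm is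
infinite. -/

/-! ### Haar probability measure on the torus -/

theorem haarAddCircle_eq_volume :
    (AddCircle.haarAddCircle : Measure UnitAddCircle) = volume := by
  rw [AddCircle.volume_eq_smul_haarAddCircle]; simp

instance : IsProbabilityMeasure (volume : Measure UnitAddCircle) := by
  rw [← haarAddCircle_eq_volume]; infer_instance

instance {d : ℕ} : IsProbabilityMeasure (volume : Measure (Torus d)) :=
  inferInstanceAs (IsProbabilityMeasure
    (Measure.pi fun _ : Fin d => (volume : Measure UnitAddCircle)))

instance {d : ℕ} : (volume : Measure (Torus d)).IsAddLeftInvariant :=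
  Measure.pi.isAddLeftInvariant (ι := Fin d) (α := fun _ => UnitAddCircle) _

instance {d : ℕ} : (volume : Measure (Torus d)).IsNegInvariant :=
  Measure.pi.isNegInvariant (ι := Fin d) (α := fun _ => UnitAddCircle) _

instance {d : ℕ} : SecondCountableTopology (Torus d) :=
  inferInstanceAs (SecondCountableTopology (Fin d → UnitAddCircle))

/-! ### Bounded measurable functions and Fubini -/

/-- Bounded measurable complex functions. -/
structure IsBdd {X : Type*} [MeasurableSpace X] (f : X → ℂ) : Prop where
  measurable : Measurable f
  bound : ∃ C : ℝ, ∀ x, ‖f x‖ ≤ C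

namespace IsBdd

variable {X Y : Type*} [MeasurableSpace X] [MeasurableSpace Y] {f g : X → ℂ}

theorem const (c : ℂ) : IsBdd (fun _ : X => c) := ⟨measurable_const, ‖c‖, fun _ => le_rfl⟩

theorem mul (hf : IsBdd f) (hg : IsBdd g) : IsBdd (fun x => f x * g x) := by
  obtain ⟨hf, C, hC⟩ := hf
  obtain ⟨hg, D, hD⟩ := hg
  refine ⟨hf.mul hg, C * D, fun x => ?_⟩
  rw [norm_mul]
  exact mul_le_mul (hC x) (hD x) (norm_nonneg _) ((norm_nonneg _).trans (hC x))

theorem sub (hf : IsBdd f) (hg : IsBdd g) : IsBdd (fun x => f x - g x) := by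
  obtain ⟨hf, C, hC⟩ := hf
  obtain ⟨hg, D, hD⟩ := hg
  exact ⟨hf.sub hg, C + D, fun x => (norm_sub_le _ _).trans (add_le_add (hC x) (hD x))⟩

theorem star (hf : IsBdd f) : IsBdd (fun x => conj (f x)) := by
  obtain ⟨hf, C, hC⟩ := hf
  exact ⟨Complex.continuous_conj.measurable.comp hf, C, fun x => by simpa using hC x⟩

theorem comp (hf : IsBdd f) {e : Y → X} (he : Measurable e) : IsBdd (fun y => f (e y)) := by
  obtain ⟨hf, C, hC⟩ := hf
  exact ⟨hf.comp he, C, fun y => hC _⟩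

theorem prod {ι : Type*} (s : Finset ι) {F : ι → X → ℂ} (h : ∀ i ∈ s, IsBdd (F i)) :
    IsBdd (fun x => ∏ i ∈ s, F i x) := by
  classical
  induction s using Finset.induction_on with
  | empty => simpa using const 1
  | insert a s ha ih =>
    simp only [Finset.prod_insert ha]
    exact (h a (by simp)).mul (ih fun i hi => h i (by simp [hi]))

theorem integrable (hf : IsBdd f) (m : Measure X) [IsFiniteMeasure m] : Integrable f m := by
  obtain ⟨hf, C, hC⟩ := hf
  exact Integrable.of_bound hf.aestronglyMeasurable C (Eventually.of_forall hC)

theorem memLp (hf : IsBdd f) (m : Measure X) [IsFiniteMeasure m] (p : ℝ≥0∞) : MemLp f p m := by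
  obtain ⟨hf, C, hC⟩ := hf
  exact MemLp.of_bound hf.aestronglyMeasurable C (Eventually.of_forall hC)

theorem integral {F : X × Y → ℂ} (hF : IsBdd F) (m : Measure Y) [IsProbabilityMeasure m] :
    IsBdd (fun x => ∫ y, F (x, y) ∂m) := by
  obtain ⟨hF, C, hC⟩ := hF
  refine ⟨(hF.stronglyMeasurable.integral_prod_right' (ν := m)).measurable, C, fun x => ?_⟩
  simpa using norm_integral_le_of_norm_le_const (μ := m)
    (Eventually.of_forall fun y => hC (x, y))

end IsBdd

theorem IsBdd.of_continuous {X : Type*} [TopologicalSpace X] [CompactSpace X] [MeasurableSpace X]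
    [BorelSpace X] {f : X → ℂ} (hf : Continuous f) : IsBdd f := by
  obtain ⟨C, hC⟩ := (isCompact_range hf).isBounded.exists_norm_le
  exact ⟨hf.measurable, C, fun x => hC _ ⟨x, rfl⟩⟩

theorem integral_swap_of_isBdd {X Y : Type*} [MeasurableSpace X] [MeasurableSpace Y]
    {m : Measure X} {n : Measure Y} [IsProbabilityMeasure m] [IsProbabilityMeasure n]
    {F : X → Y → ℂ} (hF : IsBdd (fun p : X × Y => F p.1 p.2)) :
    ∫ x, ∫ y, F x y ∂n ∂m = ∫ y, ∫ x, F x y ∂m ∂n :=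
  integral_integral_swap (hF.integrable _)

/-! ### Fourier analysis on the torus: Parseval, correlations, Bessel -/

variable {d k : ℕ}

/-- Fourier coefficients of functions on the torus. -/
noncomputable def coeff (g : Torus d → ℂ) (c : Fin d → ℤ) : ℂ :=
  ∫ x, UnitAddTorus.mFourier (-c) x * g x

theorem pi_haarAddCircle_eq_volume :
    (Measure.pi fun _ : Fin d => (AddCircle.haarAddCircle : Measure UnitAddCircle))
      = (volume : Measure (Torus d)) := by
  simp_rw [haarAddCircle_eq_volume]; rfl

theorem mFourierCoeff_eq_coeff (g : Torus d → ℂ) (c : Fin d → ℤ) :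
    UnitAddTorus.mFourierCoeff g c = coeff g c := by
  rw [coeff, ← pi_haarAddCircle_eq_volume]; rfl

theorem isBdd_mFourier (c : Fin d → ℤ) :
    IsBdd (fun x : Torus d => UnitAddTorus.mFourier c x) :=
  .of_continuous (UnitAddTorus.mFourier c).continuous

theorem norm_mFourier_apply (c : Fin d → ℤ) (x : Torus d) : ‖UnitAddTorus.mFourier c x‖ = 1 := by
  simp only [UnitAddTorus.mFourier, ContinuousMap.coe_mk, norm_prod, fourier_apply]
  exact Finset.prod_eq_one fun _ _ => Circle.norm_coe _

theorem mFourier_add_apply (c : Fin d → ℤ) (x y : Torus d) :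
    UnitAddTorus.mFourier c (x + y) = UnitAddTorus.mFourier c x * UnitAddTorus.mFourier c y := by
  simp [UnitAddTorus.mFourier, Finset.prod_mul_distrib, fourier_apply, AddCircle.toCircle_add]

theorem mFourier_neg_apply (c : Fin d → ℤ) (x : Torus d) :
    UnitAddTorus.mFourier c (-x) = UnitAddTorus.mFourier (-c) x := by
  simp [UnitAddTorus.mFourier, fourier_apply]

theorem mFourier_sub_apply (c : Fin d → ℤ) (x y : Torus d) :
    UnitAddTorus.mFourier c (x - y) = UnitAddTorus.mFourier c x * UnitAddTorus.mFourier (-c) y := by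
  rw [sub_eq_add_neg, mFourier_add_apply, mFourier_neg_apply]

theorem parseval {g : Torus d → ℂ} (hg : IsBdd g) :
    ∫⁻ x, ‖g x‖ₑ ^ 2 = ∑' c, ‖coeff g c‖ₑ ^ 2 := by
  have hm : MemLp g 2 (Measure.pi fun _ : Fin d =>
      (AddCircle.haarAddCircle : Measure UnitAddCircle)) := by
    rw [pi_haarAddCircle_eq_volume]; exact hg.memLp _ _
  have h := UnitAddTorus.hasSum_sq_mFourierCoeff (d := Fin d) hm.toLp
  have e1 : ∀ c, UnitAddTorus.mFourierCoeff (hm.toLp : Torus d → ℂ) c = coeff g c := by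
    intro c
    rw [← mFourierCoeff_eq_coeff]
    refine integral_congr_ae ?_
    filter_upwards [hm.coeFn_toLp] with x hx
    rw [hx]
  have e2 : ∫ x, ‖(hm.toLp : Torus d → ℂ) x‖ ^ 2 ∂(Measure.pi fun _ : Fin d =>
      (AddCircle.haarAddCircle : Measure UnitAddCircle)) = ∫ x, ‖g x‖ ^ 2 := by
    rw [← pi_haarAddCircle_eq_volume]
    refine integral_congr_ae ?_
    filter_upwards [hm.coeFn_toLp] with x hx
    rw [hx]
  simp only [e1] at h
  replace h : HasSum (fun c => ‖coeff g c‖ ^ 2) (∫ x, ‖g x‖ ^ 2) := e2 ▸ h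
  have h' := congrArg ENNReal.ofReal h.tsum_eq
  rw [ENNReal.ofReal_tsum_of_nonneg (fun _ => by positivity) h.summable,
    ofReal_integral_eq_lintegral_ofReal ((hg.memLp volume 2).integrable_norm_pow (by norm_num))
      (Eventually.of_forall fun _ => by positivity)] at h'
  simpa [ENNReal.ofReal_pow] using h'.symm

/-- The correlation `v ↦ ∫ A(x) conj B(x - v) dx`. -/
noncomputable def corr (A B : Torus d → ℂ) (v : Torus d) : ℂ := ∫ x, A x * conj (B (x - v))

theorem IsBdd.corr {A B : Torus d → ℂ} (hA : IsBdd A) (hB : IsBdd B) : IsBdd (corr A B) :=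
  IsBdd.integral (F := fun p : Torus d × Torus d => A p.2 * conj (B (p.2 - p.1)))
    ((hA.comp measurable_snd).mul (hB.comp (measurable_snd.sub measurable_fst)).star) volume

/-- A correlation is the convolution of `A` with the reflected conjugate of `B`; after Fubini, the
substitution `v = x - y` separates the character. -/
theorem coeff_corr {A B : Torus d → ℂ} (hA : IsBdd A) (hB : IsBdd B) (c : Fin d → ℤ) :
    coeff (corr A B) c = coeff A c * conj (coeff B c) := by
  have h : ∀ v, UnitAddTorus.mFourier (-c) v * corr A B v
      = ∫ x, UnitAddTorus.mFourier (-c) v * (A x * conj (B (x - v))) := fun v => by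
    rw [corr, integral_const_mul]
  simp only [coeff, h]
  rw [integral_swap_of_isBdd (F := fun v x : Torus d =>
    UnitAddTorus.mFourier (-c) v * (A x * conj (B (x - v))))
    (((isBdd_mFourier (-c)).comp measurable_fst).mul
      ((hA.comp measurable_snd).mul (hB.comp (measurable_snd.sub measurable_fst)).star))]
  have h2 : ∀ x, ∫ v, UnitAddTorus.mFourier (-c) v * (A x * conj (B (x - v)))
      = UnitAddTorus.mFourier (-c) x * A x
        * conj (∫ y, UnitAddTorus.mFourier (-c) y * B y) := fun x => by
    rw [← integral_sub_left_eq_self _ volume x, ← integral_conj, ← integral_const_mul]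
    refine integral_congr_ae (Eventually.of_forall fun y => ?_)
    simp only [sub_sub_cancel, mFourier_sub_apply, neg_neg, map_mul, ← UnitAddTorus.mFourier_neg]
    ring
  simp only [h2, integral_mul_const]

theorem lintegral_corr {A B : Torus d → ℂ} (hA : IsBdd A) (hB : IsBdd B) :
    ∫⁻ v, ‖corr A B v‖ₑ ^ 2 = ∑' c, ‖coeff A c‖ₑ ^ 2 * ‖coeff B c‖ₑ ^ 2 := by
  rw [parseval (hA.corr hB)]
  simp [coeff_corr hA hB, enorm_mul, mul_pow]

theorem isBdd_kernel (φ : C(Torus d, ℝ)) : IsBdd (fun x => (φ x : ℂ)) :=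
  .of_continuous (by fun_prop)

theorem coeff_conv (φ : C(Torus d, ℝ)) {g : Torus d → ℂ} (hg : IsBdd g) (c : Fin d → ℤ) :
    coeff (fun x => ∫ y, (φ y : ℂ) * g (x - y)) c = kernelCoeff φ c * coeff g c := by
  simp only [coeff, ← integral_const_mul]
  rw [integral_swap_of_isBdd (F := fun x y : Torus d =>
    UnitAddTorus.mFourier (-c) x * ((φ y : ℂ) * g (x - y)))
    (((isBdd_mFourier (-c)).comp measurable_fst).mul
      (((isBdd_kernel φ).comp measurable_snd).mul (hg.comp (measurable_fst.sub measurable_snd))))]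
  have h2 : ∀ y, ∫ x, UnitAddTorus.mFourier (-c) x * ((φ y : ℂ) * g (x - y))
      = UnitAddTorus.mFourier (-c) y * φ y * ∫ x, UnitAddTorus.mFourier (-c) x * g x := fun y => by
    rw [← integral_add_right_eq_self _ y, ← integral_const_mul]
    refine integral_congr_ae (Eventually.of_forall fun x => ?_)
    simp only [add_sub_cancel_right, mFourier_add_apply]
    ring
  simp only [h2, integral_mul_const, integral_const_mul, kernelCoeff]

theorem integral_mFourier (c : Fin d → ℤ) :
    ∫ x : Torus d, UnitAddTorus.mFourier c x = if c = 0 then 1 else 0 := by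
  have h := orthonormal_iff_ite.mp (UnitAddTorus.orthonormal_mFourier (d := Fin d)) 0 c
  rw [ContinuousMap.inner_toLp] at h
  rw [← pi_haarAddCircle_eq_volume]
  simpa [eq_comm, UnitAddTorus.mFourier_zero] using! h

/-- The character `u ↦ e^{2πi (η_1·u_1 + ⋯ + η_m·u_m)}`. -/
noncomputable def multiChar {m : ℕ} (η : Fin m → Fin d → ℤ) : C(Fin m → Torus d, ℂ) where
  toFun u := ∏ i, UnitAddTorus.mFourier (η i) (u i)
  continuous_toFun := by fun_prop

theorem orthonormal_multiChar {m : ℕ} : Orthonormal ℂ (fun η : Fin m → Fin d → ℤ =>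
    ContinuousMap.toLp (E := ℂ) 2 (volume : Measure (Fin m → Torus d)) ℂ (multiChar η)) := by
  rw [orthonormal_iff_ite]
  intro η ξ
  rw [ContinuousMap.inner_toLp]
  have h : ∀ u : Fin m → Torus d, multiChar ξ u * conj (multiChar η u)
      = ∏ i, UnitAddTorus.mFourier (ξ i + -η i) (u i) := fun u => by
    simp only [multiChar, ContinuousMap.coe_mk, map_prod, ← Finset.prod_mul_distrib,
      UnitAddTorus.mFourier_add, UnitAddTorus.mFourier_neg]
  simp only [h]
  rw [volume_pi, integral_fintype_prod_eq_prod
    (f := fun i (x : Torus d) => UnitAddTorus.mFourier (ξ i + -η i) x)]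
  simp only [integral_mFourier, ← sub_eq_add_neg, sub_eq_zero]
  rw [Finset.prod_ite_zero]
  simp [funext_iff, eq_comm]

theorem bessel {m : ℕ} {g : (Fin m → Torus d) → ℂ} (hg : IsBdd g) :
    ∑' η : Fin m → Fin d → ℤ, ‖∫ u, (∏ i, UnitAddTorus.mFourier (-(η i)) (u i)) * g u‖ₑ ^ 2
      ≤ ∫⁻ u, ‖g u‖ₑ ^ 2 := by
  have hm := hg.memLp (volume : Measure (Fin m → Torus d)) 2
  have e1 : ∀ η : Fin m → Fin d → ℤ, inner ℂ (ContinuousMap.toLp (E := ℂ) 2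
      (volume : Measure (Fin m → Torus d)) ℂ (multiChar η)) hm.toLp
      = ∫ u, (∏ i, UnitAddTorus.mFourier (-(η i)) (u i)) * g u := fun η => by
    rw [L2.inner_def]
    refine integral_congr_ae ?_
    filter_upwards [hm.coeFn_toLp, ContinuousMap.coeFn_toLp (p := 2) (𝕜 := ℂ)
      (volume : Measure (Fin m → Torus d)) (multiChar η)] with u h1 h2
    rw [h1, h2]
    simp [multiChar, UnitAddTorus.mFourier_neg, mul_comm]
  have e2 : ENNReal.ofReal (‖hm.toLp‖ ^ 2) = ∫⁻ u, ‖g u‖ₑ ^ 2 := by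
    rw [ENNReal.ofReal_pow (norm_nonneg _), ofReal_norm, Lp.enorm_toLp,
      eLpNorm_eq_lintegral_rpow_enorm_toReal (by norm_num) (by norm_num)]
    rw [← ENNReal.rpow_natCast, ← ENNReal.rpow_mul]
    simp
  rw [ENNReal.tsum_eq_iSup_sum]
  refine iSup_le fun s => ?_
  have h := (orthonormal_multiChar (d := d) (m := m)).sum_inner_products_le hm.toLp (s := s)
  simp only [e1] at h
  rw [← e2]
  refine le_trans (le_of_eq ?_) (ENNReal.ofReal_le_ofReal h)
  rw [ENNReal.ofReal_sum_of_nonneg fun _ _ => by positivity]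
  simp [ENNReal.ofReal_pow]

/-! ### Analytic families for the three lines theorem -/

section ThreeLines

open Complex.HadamardThreeLines

variable {Y : Type*} [MeasurableSpace Y] {m : Measure Y} [IsProbabilityMeasure m]

theorem mul_exp_le_of_mem_Icc {c β α M x : ℝ} (hc : 0 ≤ c) (h0 : c * Real.exp β ≤ M)
    (h1 : c * Real.exp (β + α) ≤ M) (hx : x ∈ Set.Icc (0 : ℝ) 1) :
    c * Real.exp (β + x * α) ≤ M := by
  rcases le_total α 0 with hα | hα
  · refine le_trans (mul_le_mul_of_nonneg_left (Real.exp_le_exp.mpr ?_) hc) h0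
    nlinarith [hx.1]
  · refine le_trans (mul_le_mul_of_nonneg_left (Real.exp_le_exp.mpr ?_) hc) h1
    nlinarith [hx.2]

/-- Since `ε|α| ≤ exp(ε|α|)`, the factor `|α|` is paid for by moving `x` a distance `ε` in the
direction of growth, which stays inside `[0, 1]`. -/
theorem mul_abs_exp_le_of_mem_Icc {c β α M x ε : ℝ} (hε : 0 < ε) (hc : 0 ≤ c)
    (h0 : c * Real.exp β ≤ M) (h1 : c * Real.exp (β + α) ≤ M)
    (hx : x ∈ Set.Icc ε (1 - ε)) :
    c * Real.exp (β + x * α) * |α| ≤ ε⁻¹ * M := by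
  have key : Real.exp (ε * |α|) ≥ ε * |α| := by linarith [Real.add_one_le_exp (ε * |α|)]
  have step : c * Real.exp (β + x * α) * Real.exp (ε * |α|) ≤ M := by
    rw [mul_assoc, ← Real.exp_add]
    rcases abs_cases α with ⟨h, hα⟩ | ⟨h, hα⟩
    · rw [h, show β + x * α + ε * α = β + (x + ε) * α by ring]
      exact mul_exp_le_of_mem_Icc hc h0 h1 ⟨by linarith [hx.1], by linarith [hx.2]⟩
    · rw [h, show β + x * α + ε * -α = β + (x - ε) * α by ring]
      exact mul_exp_le_of_mem_Icc hc h0 h1 ⟨by linarith [hx.1], by linarith [hx.2]⟩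
  have h2 : c * Real.exp (β + x * α) * (ε * |α|) ≤ M :=
    le_trans (mul_le_mul_of_nonneg_left key (by positivity)) step
  rw [← div_eq_inv_mul, le_div_iff₀ hε]
  linarith

/-- The exponent `α` may be unbounded (it will be a difference of logarithms), so the `z`-derivative
is dominated only on inner strips `ε ≤ Re z ≤ 1 - ε`; continuity up to the boundary needs only the
bound `M`. -/
theorem diffContOnCl_integral_exp {c : Y → ℂ} {α β : Y → ℝ} (hc : Measurable c)
    (hα : Measurable α) (hβ : Measurable β) {M : ℝ}
    (h0 : ∀ y, ‖c y‖ * Real.exp (β y) ≤ M) (h1 : ∀ y, ‖c y‖ * Real.exp (β y + α y) ≤ M) :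
    DiffContOnCl ℂ (fun z : ℂ => ∫ y, c y * Complex.exp (β y + z * α y) ∂m)
      (verticalStrip 0 1) ∧ ∀ z ∈ verticalClosedStrip 0 1,
      ‖∫ y, c y * Complex.exp (β y + z * α y) ∂m‖ ≤ M := by
  have hnorm : ∀ (z : ℂ) y, ‖c y * Complex.exp (β y + z * α y)‖
      = ‖c y‖ * Real.exp (β y + z.re * α y) := fun z y => by
    rw [norm_mul, Complex.norm_exp]; simp
  have hmeas : ∀ z : ℂ, Measurable fun y => c y * Complex.exp (β y + z * α y) := fun z => by
    fun_prop
  have hbd : ∀ z : ℂ, z.re ∈ Set.Icc (0 : ℝ) 1 →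
      ∀ y, ‖c y * Complex.exp (β y + z * α y)‖ ≤ M := fun z hz y => by
    rw [hnorm]; exact mul_exp_le_of_mem_Icc (norm_nonneg _) (h0 y) (h1 y) hz
  refine ⟨⟨?_, ?_⟩, fun z hz => by
    simpa using norm_integral_le_of_norm_le_const (μ := m) (Eventually.of_forall (hbd z hz))⟩
  · intro z hz
    obtain ⟨hz0, hz1⟩ : 0 < z.re ∧ z.re < 1 := hz
    obtain ⟨ε, hε, hε0, hε1⟩ : ∃ ε > 0, 2 * ε < z.re ∧ z.re < 1 - 2 * ε :=
      ⟨min z.re (1 - z.re) / 4, by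
        have := lt_min hz0 (sub_pos.mpr hz1); positivity,
        by linarith [min_le_left z.re (1 - z.re)], by linarith [min_le_right z.re (1 - z.re)]⟩
    have hs : {w : ℂ | w.re ∈ Set.Icc ε (1 - ε)} ∈ 𝓝 z := by
      refine Filter.mem_of_superset (Complex.continuous_re.continuousAt.preimage_mem_nhds
        (Icc_mem_nhds (a := ε) (b := 1 - ε) ?_ ?_)) fun _ h => h <;> linarith
    refine (hasDerivAt_integral_of_dominated_loc_of_deriv_le (bound := fun _ => ε⁻¹ * M)
      (F' := fun w y => c y * (Complex.exp (β y + w * α y) * α y)) hs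
      (Eventually.of_forall fun w => (hmeas w).aestronglyMeasurable)
      (Integrable.of_bound (hmeas z).aestronglyMeasurable M
        (Eventually.of_forall (hbd z ⟨hz0.le, hz1.le⟩)))
      (by fun_prop) ?_ (integrable_const _) ?_).2.differentiableAt.differentiableWithinAt
    · refine Eventually.of_forall fun y w hw => ?_
      rw [← mul_assoc, norm_mul, hnorm, Complex.norm_real, Real.norm_eq_abs]
      exact mul_abs_exp_le_of_mem_Icc hε (norm_nonneg _) (h0 y) (h1 y) hw
    · refine Eventually.of_forall fun y w _ => ?_
      have h : HasDerivAt (fun w : ℂ => (β y : ℂ) + w * α y) (α y) w := by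
        simpa using ((hasDerivAt_id w).mul_const (α y : ℂ)).const_add (β y : ℂ)
      exact h.cexp.const_mul (c y)
  · have hcl : closure (verticalStrip 0 1) ⊆ {w : ℂ | w.re ∈ Set.Icc (0 : ℝ) 1} :=
      closure_minimal (fun w hw => ⟨hw.1.le, hw.2.le⟩)
        (isClosed_Icc.preimage Complex.continuous_re)
    refine ContinuousOn.mono ?_ hcl
    refine continuousOn_of_dominated (bound := fun _ => M)
      (fun w _ => (hmeas w).aestronglyMeasurable)
      (fun w hw => Eventually.of_forall (hbd w hw)) (integrable_const _)
      (Eventually.of_forall fun y => ?_)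
    fun_prop

/-- `w ↦ sgn(w) |w|^s`. -/
noncomputable def phasePow (s : ℂ) (w : ℂ) : ℂ := w / ‖w‖ * Complex.exp (s * Real.log ‖w‖)

theorem phasePow_zero (s : ℂ) : phasePow s 0 = 0 := by simp [phasePow]

/-- Equality fails only at `w = 0`, `Re s = 0`, where the right side is `0 ^ 0 = 1`. -/
theorem norm_phasePow_le (s w : ℂ) : ‖phasePow s w‖ ≤ ‖w‖ ^ s.re := by
  rcases eq_or_ne w 0 with rfl | hw
  · rw [phasePow_zero]; simpa using Real.rpow_nonneg le_rfl _
  · have h : 0 < ‖w‖ := norm_pos_iff.mpr hw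
    rw [phasePow, norm_mul, Complex.norm_exp, norm_div, Complex.norm_real, norm_norm,
      div_self h.ne', one_mul, Real.rpow_def_of_pos h]
    simp [mul_comm]

theorem phasePow_one (w : ℂ) : phasePow 1 w = w := by
  rcases eq_or_ne w 0 with rfl | hw
  · exact phasePow_zero 1
  · have h : 0 < ‖w‖ := norm_pos_iff.mpr hw
    rw [phasePow, one_mul, ← Complex.ofReal_exp, Real.exp_log h,
      div_mul_cancel₀ _ (by exact_mod_cast h.ne')]

theorem phasePow_three_mul_conj (w : ℂ) : phasePow 3 (conj w) * w = ((‖w‖ ^ 4 : ℝ) : ℂ) := by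
  rcases eq_or_ne w 0 with rfl | hw
  · simp
  · have h : 0 < ‖w‖ := norm_pos_iff.mpr hw
    have h' : (‖w‖ : ℂ) ≠ 0 := by exact_mod_cast h.ne'
    have e : Complex.exp (3 * Real.log ‖w‖) = (‖w‖ : ℂ) ^ 3 := by
      rw [show (3 : ℂ) * Real.log ‖w‖ = ((3 : ℕ) : ℂ) * Real.log ‖w‖ by norm_num,
        Complex.exp_nat_mul, ← Complex.ofReal_exp, Real.exp_log h]
    rw [phasePow, Complex.norm_conj, e]
    have := Complex.conj_mul' w
    field_simp
    rw [mul_right_comm, this]; push_cast; ring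

theorem measurable_phasePow (s : ℂ) : Measurable (phasePow s) := by
  unfold phasePow; fun_prop

theorem IsBdd.phasePow {f : Y → ℂ} (hf : IsBdd f) {s : ℂ} (hs : 0 ≤ s.re) :
    IsBdd (fun y => phasePow s (f y)) := by
  obtain ⟨hf, C, hC⟩ := hf
  exact ⟨(measurable_phasePow s).comp hf, C ^ s.re, fun y =>
    (norm_phasePow_le _ _).trans (Real.rpow_le_rpow (norm_nonneg _) (hC y) hs)⟩

/-- Both powers merge into one exponential, affine in `z`, whose coefficient carries the phases.
That coefficient vanishes where `P` or `Q` does, so the convention `log 0 = 0` is harmless. -/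
theorem diffContOnCl_integral_phasePow {w P Q : Y → ℂ} (hw : IsBdd w) (hP : IsBdd P)
    (hQ : IsBdd Q) :
    DiffContOnCl ℂ (fun z : ℂ => ∫ y, w y * (phasePow (4 - 2 * z) (Q y) * phasePow (2 * z) (P y)) ∂m)
      (verticalStrip 0 1) ∧ ∃ M, ∀ z ∈ verticalClosedStrip 0 1,
      ‖∫ y, w y * (phasePow (4 - 2 * z) (Q y) * phasePow (2 * z) (P y)) ∂m‖ ≤ M := by
  obtain ⟨hP, C, hC⟩ := hP
  obtain ⟨hQ, D, hD⟩ := hQ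
  obtain ⟨hw, W, hW⟩ := hw
  have h := diffContOnCl_integral_exp (m := m)
    (c := fun y => w y * (Q y / ‖Q y‖ * (P y / ‖P y‖)))
    (α := fun y => 2 * Real.log ‖P y‖ - 2 * Real.log ‖Q y‖) (β := fun y => 4 * Real.log ‖Q y‖)
    (by fun_prop) (by fun_prop) (by fun_prop)
    -- The modulus is `|w||Q|⁴` on `Re z = 0` and `|w||Q|²|P|²` on `Re z = 1`, away from zeros.
    (M := W * max (D ^ 4) (D ^ 2 * C ^ 2)) ?_ ?_
  · have e : ∀ z y, w y * (phasePow (4 - 2 * z) (Q y) * phasePow (2 * z) (P y))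
        = w y * (Q y / ‖Q y‖ * (P y / ‖P y‖)) * Complex.exp ((4 * Real.log ‖Q y‖ : ℝ)
          + z * (2 * Real.log ‖P y‖ - 2 * Real.log ‖Q y‖ : ℝ)) := fun z y => by
      simp only [phasePow]
      rw [mul_mul_mul_comm, ← Complex.exp_add, ← mul_assoc]
      congr 2
      push_cast
      ring
    simp only [e]
    exact ⟨h.1, _, h.2⟩
  all_goals
    intro y
    have hW0 := (norm_nonneg _).trans (hW y)
    have hD0 := (norm_nonneg _).trans (hD y)
    have hM : 0 ≤ max (D ^ 4) (D ^ 2 * C ^ 2) := le_max_of_le_left (by positivity)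
    rcases eq_or_ne (Q y) 0 with h | hQ0
    · simp only [h]; simp; positivity
    rcases eq_or_ne (P y) 0 with h | hP0
    · simp only [h]; simp; positivity
    have hp : 0 < ‖P y‖ := norm_pos_iff.mpr hP0
    have hq : 0 < ‖Q y‖ := norm_pos_iff.mpr hQ0
    simp only [norm_mul, norm_div, Complex.norm_real, norm_norm, div_self hp.ne',
      div_self hq.ne', mul_one]
    refine mul_le_mul (hW y) ?_ (Real.exp_pos _).le hW0
  · refine le_trans ?_ (le_max_left _ _)
    rw [show 4 * Real.log ‖Q y‖ = ((4 : ℕ) : ℝ) * Real.log ‖Q y‖ by norm_num, Real.exp_nat_mul,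
      Real.exp_log hq]
    gcongr; exact hD y
  · refine le_trans ?_ (le_max_right _ _)
    rw [show 4 * Real.log ‖Q y‖ + (2 * Real.log ‖P y‖ - 2 * Real.log ‖Q y‖)
      = ((2 : ℕ) : ℝ) * Real.log ‖Q y‖ + ((2 : ℕ) : ℝ) * Real.log ‖P y‖ by push_cast; ring,
      Real.exp_add, Real.exp_nat_mul, Real.exp_nat_mul, Real.exp_log hq, Real.exp_log hp]
    gcongr
    · exact hD y
    · exact hC y

end ThreeLines

/-! ### Convolution with `δ_0 - φ` on `L²`, `L^∞` and `L⁴` -/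

section Contraction

open Complex.HadamardThreeLines

/-- Convolution of a function on the torus with `δ_0 - φ`. -/
noncomputable def convCompl (φ : C(Torus d, ℝ)) (b : Torus d → ℂ) (x : Torus d) : ℂ :=
  b x - ∫ y, (φ y : ℂ) * b (x - y)

theorem IsBdd.convCompl (φ : C(Torus d, ℝ)) {b : Torus d → ℂ} (hb : IsBdd b) :
    IsBdd (convCompl φ b) :=
  hb.sub (IsBdd.integral (F := fun p : Torus d × Torus d => (φ p.2 : ℂ) * b (p.1 - p.2))
    (((isBdd_kernel φ).comp measurable_snd).mul
      (hb.comp (measurable_fst.sub measurable_snd))) volume)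

theorem coeff_convCompl (φ : C(Torus d, ℝ)) {b : Torus d → ℂ} (hb : IsBdd b) (c : Fin d → ℤ) :
    coeff (convCompl φ b) c = (1 - kernelCoeff φ c) * coeff b c := by
  have h2 := coeff_conv φ hb c
  have hi : IsBdd fun x => ∫ y, (φ y : ℂ) * b (x - y) :=
    (IsBdd.integral (F := fun p : Torus d × Torus d => (φ p.2 : ℂ) * b (p.1 - p.2))
    (((isBdd_kernel φ).comp measurable_snd).mul
      (hb.comp (measurable_fst.sub measurable_snd))) volume)
  have : coeff (convCompl φ b) c = coeff b c - coeff (fun x => ∫ y, (φ y : ℂ) * b (x - y)) c := by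
    simp only [coeff, convCompl, mul_sub]
    exact integral_sub (((isBdd_mFourier _).mul hb).integrable _)
      (((isBdd_mFourier _).mul hi).integrable _)
  rw [this, h2]; ring

/-- A nonnegative kernel of integral `1` whose Fourier transform takes values in `[0, 1]`. -/
structure IsCutoffKernel (φ : C(Torus d, ℝ)) : Prop where
  nonneg : ∀ x, 0 ≤ φ x
  integral_eq_one : ∫ x, φ x = 1
  coeff_mem : ∀ c, ∃ r ∈ Set.Icc (0 : ℝ) 1, kernelCoeff φ c = r

variable {φ : C(Torus d, ℝ)} (hφ : IsCutoffKernel φ)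
include hφ

theorem IsCutoffKernel.enorm_one_sub_le (c : Fin d → ℤ) : ‖1 - kernelCoeff φ c‖ₑ ≤ 1 := by
  obtain ⟨r, ⟨h0, h1⟩, hr⟩ := hφ.coeff_mem c
  rw [hr, ← ofReal_norm, ENNReal.ofReal_le_one, ← Complex.ofReal_one, ← Complex.ofReal_sub,
    Complex.norm_real, Real.norm_eq_abs, abs_le]
  constructor <;> linarith

theorem IsCutoffKernel.enorm_coeff_convCompl_le {b : Torus d → ℂ} (hb : IsBdd b)
    (c : Fin d → ℤ) : ‖coeff (convCompl φ b) c‖ₑ ≤ ‖coeff b c‖ₑ := by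
  rw [coeff_convCompl φ hb, enorm_mul]
  exact mul_le_of_le_one_left' (hφ.enorm_one_sub_le c)

theorem IsCutoffKernel.lintegral_sq_le {b : Torus d → ℂ} (hb : IsBdd b) :
    ∫⁻ x, ‖convCompl φ b x‖ₑ ^ 2 ≤ ∫⁻ x, ‖b x‖ₑ ^ 2 := by
  rw [parseval (hb.convCompl φ), parseval hb]
  exact ENNReal.tsum_le_tsum fun c => pow_le_pow_left' (hφ.enorm_coeff_convCompl_le hb c) 2

theorem IsCutoffKernel.integral_coe_eq_one : ∫ y, (φ y : ℂ) = 1 := by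
  rw [integral_complex_ofReal, hφ.integral_eq_one, Complex.ofReal_one]

theorem IsCutoffKernel.norm_convCompl_le {b : Torus d → ℂ} {C : ℝ}
    (hC : ∀ x, ‖b x‖ ≤ C) (x : Torus d) : ‖convCompl φ b x‖ ≤ 2 * C := by
  have h : ‖∫ y, (φ y : ℂ) * b (x - y)‖ ≤ ∫ y, φ y * C := by
    refine norm_integral_le_of_norm_le ?_ (Eventually.of_forall fun y => ?_)
    · exact ((φ.continuous.integrable_of_hasCompactSupport
        (HasCompactSupport.of_compactSpace _))).mul_const C
    · rw [norm_mul, Complex.norm_real, Real.norm_eq_abs, abs_of_nonneg (hφ.nonneg y)]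
      exact mul_le_mul_of_nonneg_left (hC _) (hφ.nonneg y)
  rw [integral_mul_const, hφ.integral_eq_one, one_mul] at h
  have := norm_sub_le (b x) (∫ y, (φ y : ℂ) * b (x - y))
  have := hC x
  unfold convCompl
  linarith

omit hφ in
theorem lintegral_mul_le_sqrt {X : Type*} [MeasurableSpace X] {m : Measure X} {f g : X → ℝ≥0∞}
    (hf : AEMeasurable f m) (hg : AEMeasurable g m) :
    ∫⁻ x, f x * g x ∂m
      ≤ (∫⁻ x, f x ^ 2 ∂m) ^ (1 / 2 : ℝ) * (∫⁻ x, g x ^ 2 ∂m) ^ (1 / 2 : ℝ) := by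
  simpa using ENNReal.lintegral_mul_le_Lp_mul_Lq m Real.HolderConjugate.two_two hf hg

omit hφ in
-- The hypothesis reads `G ≤ √2 · G^{3/4} B^{1/4}`: cancel `G^{3/4}` and take fourth powers.
theorem le_four_mul_of_interpolation {G B : ℝ} (hG : 0 ≤ G) (hB : 0 ≤ B)
    (h : G ≤ (2 * G) ^ (1 - 1 / 2 : ℝ) * (G ^ (1 / 2 : ℝ) * B ^ (1 / 2 : ℝ)) ^ (1 / 2 : ℝ)) :
    G ≤ 4 * B := by
  rcases hG.eq_or_lt with rfl | hpos
  · positivity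
  rw [show (1 - 1 / 2 : ℝ) = 1 / 2 by norm_num, ← Real.sqrt_eq_rpow, ← Real.sqrt_eq_rpow,
    ← Real.sqrt_eq_rpow, ← Real.sqrt_eq_rpow, ← Real.sqrt_mul (by positivity),
    ← Real.sqrt_mul hG] at h
  have h2 : G ^ 2 ≤ 2 * G * √(G * B) := by
    calc G ^ 2 ≤ (√(2 * G * √(G * B))) ^ 2 := pow_le_pow_left₀ hG h 2
      _ = _ := Real.sq_sqrt (by positivity)
  have h3 : G ≤ 2 * √(G * B) := by nlinarith
  have h4 : G ^ 2 ≤ 4 * (G * B) := by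
    calc G ^ 2 ≤ (2 * √(G * B)) ^ 2 := pow_le_pow_left₀ hG h3 2
      _ = _ := by rw [mul_pow, Real.sq_sqrt (by positivity)]; norm_num
  nlinarith

/-- Riesz–Thorin by hand at the midpoint of `L^∞` (norm `2`) and `L²` (norm `1`), with the dual
function built from `g = T b` itself, where `T` is convolution with `δ_0 - φ`. -/
theorem IsCutoffKernel.lintegral_pow_four_le {b : Torus d → ℂ} (hb : IsBdd b) :
    ∫⁻ x, ‖convCompl φ b x‖ₑ ^ 4 ≤ 4 * ∫⁻ x, ‖b x‖ₑ ^ 4 := by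
  set g := convCompl φ b
  have hg : IsBdd g := hb.convCompl φ
  have hgc : IsBdd fun x => conj (g x) := hg.star
  have hK := isBdd_kernel φ
  have hsub : Measurable fun p : Torus d × Torus d => p.1 - p.2 :=
    measurable_fst.sub measurable_snd
  -- This is the pairing of `sgn(ḡ)|g|^{4-2z}` with `T(sgn(b)|b|^{2z})`. Because `∫ φ = 1`, the
  -- identity part of `T` can also be written with weight `φ(y)`, so both terms are of the form
  -- already shown to be analytic.
  let F : ℂ → ℂ := fun z =>
    (∫ p : Torus d × Torus d, (φ p.2 : ℂ) *
      (phasePow (4 - 2 * z) (conj (g p.1)) * phasePow (2 * z) (b p.1)))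
    - ∫ p : Torus d × Torus d, (φ p.2 : ℂ) *
      (phasePow (4 - 2 * z) (conj (g p.1)) * phasePow (2 * z) (b (p.1 - p.2)))
  obtain ⟨d1, M1, b1⟩ := diffContOnCl_integral_phasePow
    (m := (volume : Measure (Torus d × Torus d))) (hK.comp measurable_snd)
    (hb.comp measurable_fst) (hgc.comp measurable_fst)
  obtain ⟨d2, M2, b2⟩ := diffContOnCl_integral_phasePow
    (m := (volume : Measure (Torus d × Torus d))) (hK.comp measurable_snd)
    (hb.comp hsub) (hgc.comp measurable_fst)
  have hFd : DiffContOnCl ℂ F (verticalStrip 0 1) := d1.sub d2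
  have hFb : BddAbove ((norm ∘ F) '' verticalClosedStrip 0 1) := by
    refine ⟨M1 + M2, ?_⟩
    rintro _ ⟨z, hz, rfl⟩
    exact (norm_sub_le _ _).trans (add_le_add (b1 z hz) (b2 z hz))
  have hre0 : ∀ {z : ℂ}, 0 ≤ z.re → 0 ≤ (2 * z).re := fun h => by simpa using h
  have hre1 : ∀ {z : ℂ}, z.re ≤ 1 → 0 ≤ (4 - 2 * z).re := fun {z} h => by
    have : (4 - 2 * z).re = 4 - 2 * z.re := by simp
    linarith
  have hF : ∀ z : ℂ, 0 ≤ z.re → z.re ≤ 1 → F z = ∫ x, phasePow (4 - 2 * z) (conj (g x)) *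
      convCompl φ (fun x => phasePow (2 * z) (b x)) x := fun z hz0 hz1 => by
    have hP := hb.phasePow (hre0 hz0)
    have hQ := hgc.phasePow (hre1 hz1)
    have i1 := (hK.comp measurable_snd).mul ((hQ.comp measurable_fst).mul (hP.comp measurable_fst))
    have i2 := (hK.comp measurable_snd).mul ((hQ.comp measurable_fst).mul
      (hP.comp hsub))
    have e1 := integral_prod _ (i1.integrable ((volume : Measure (Torus d)).prod volume))
    have e2 := integral_prod _ (i2.integrable ((volume : Measure (Torus d)).prod volume))
    simp only [F]
    rw [Measure.volume_eq_prod, e1, e2, ← integral_sub]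
    · refine integral_congr_ae (Eventually.of_forall fun x => ?_)
      simp only [integral_mul_const, hφ.integral_coe_eq_one, convCompl, mul_left_comm (φ _ : ℂ),
        integral_const_mul]
      ring
    · exact (IsBdd.integral i1 volume).integrable _
    · exact (IsBdd.integral i2 volume).integrable _
  have fin4 : ∀ {f : Torus d → ℂ}, IsBdd f → ∫⁻ x, ‖f x‖ₑ ^ 4 ≠ ∞ := fun {f} hf => by
    have h := ((hf.memLp volume 4).integrable_norm_pow (by norm_num)).hasFiniteIntegral
    simpa [HasFiniteIntegral] using h.ne
  set G := ∫⁻ x, ‖g x‖ₑ ^ 4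
  set B := ∫⁻ x, ‖b x‖ₑ ^ 4
  have hG : G ≠ ∞ := fin4 hg
  have hB : B ≠ ∞ := fin4 hb
  -- Here `|b|^{2z}` is unimodular or zero, so the `L^∞` bound applies, and the other factor has
  -- modulus at most `|g|⁴`.
  have left : ∀ z ∈ Complex.re ⁻¹' {(0 : ℝ)}, ‖F z‖ ≤ 2 * G.toReal := by
    intro z hz
    have hz : z.re = 0 := hz
    rw [← ENNReal.toReal_ofNat 2, ← ENNReal.toReal_mul, ← toReal_enorm]
    refine ENNReal.toReal_mono (by finiteness) ?_
    rw [hF z hz.ge (by simp [hz])]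
    refine (enorm_integral_le_lintegral_enorm _).trans ?_
    rw [← lintegral_const_mul' _ _ (by simp)]
    refine lintegral_mono fun x => ?_
    rw [enorm_mul, mul_comm]
    refine mul_le_mul' ?_ ?_
    · rw [← ofReal_norm, ← ENNReal.ofReal_ofNat 2]
      refine ENNReal.ofReal_le_ofReal ?_
      simpa using hφ.norm_convCompl_le (C := 1) (fun x => by
        simpa [hz] using norm_phasePow_le (2 * z) (b x)) x
    · rw [← ofReal_norm, ← ofReal_norm, ← ENNReal.ofReal_pow (norm_nonneg _)]
      refine ENNReal.ofReal_le_ofReal ((norm_phasePow_le _ _).trans (le_of_eq ?_))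
      rw [Complex.norm_conj, ← Real.rpow_natCast]; simp [hz]
  have hsq : ∀ (s w : ℂ), s.re = 2 → ‖phasePow s w‖ₑ ^ 2 ≤ ‖w‖ₑ ^ 4 := fun s w hs => by
    rw [← ofReal_norm, ← ofReal_norm, ← ENNReal.ofReal_pow (norm_nonneg _),
      ← ENNReal.ofReal_pow (norm_nonneg _)]
    refine ENNReal.ofReal_le_ofReal ?_
    have := norm_phasePow_le s w
    rw [hs, Real.rpow_two] at this
    calc ‖phasePow s w‖ ^ 2 ≤ (‖w‖ ^ 2) ^ 2 := pow_le_pow_left₀ (norm_nonneg _) this 2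
      _ = ‖w‖ ^ 4 := by ring
  -- Both powers now have modulus at most a square: Cauchy–Schwarz and the `L²` contraction.
  have right : ∀ z ∈ Complex.re ⁻¹' {(1 : ℝ)},
      ‖F z‖ ≤ G.toReal ^ (1 / 2 : ℝ) * B.toReal ^ (1 / 2 : ℝ) := by
    intro z hz
    have hz : z.re = 1 := hz
    have hP := hb.phasePow (hre0 (z := z) (by simp [hz]))
    have hQ := hgc.phasePow (hre1 hz.le)
    rw [ENNReal.toReal_rpow, ENNReal.toReal_rpow, ← ENNReal.toReal_mul, ← toReal_enorm]
    refine ENNReal.toReal_mono (by finiteness) ?_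
    rw [hF z (by simp [hz]) hz.le]
    refine (enorm_integral_le_lintegral_enorm _).trans ?_
    simp only [enorm_mul]
    refine (lintegral_mul_le_sqrt hQ.measurable.enorm.aemeasurable
      (hP.convCompl φ).measurable.enorm.aemeasurable).trans ?_
    gcongr
    · refine lintegral_mono fun x => ?_
      have := hsq (4 - 2 * z) (conj (g x)) (by simp [hz]; norm_num)
      simpa [← ofReal_norm] using this
    · refine (hφ.lintegral_sq_le hP).trans (lintegral_mono fun x => hsq _ _ ?_)
      simp [hz]
  -- At the midpoint the pairing is `sgn(ḡ)|g|³ · g = |g|⁴`.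
  have mid : ‖F (1 / 2)‖ = G.toReal := by
    rw [hF _ (by norm_num) (by norm_num)]
    have e : ∀ x, phasePow (4 - 2 * (1 / 2)) (conj (g x)) *
        convCompl φ (fun x => phasePow (2 * (1 / 2)) (b x)) x = ((‖g x‖ ^ 4 : ℝ) : ℂ) := fun x => by
      rw [show (4 - 2 * (1 / 2) : ℂ) = 3 by norm_num, show (2 * (1 / 2) : ℂ) = 1 by norm_num]
      simp only [phasePow_one]
      exact phasePow_three_mul_conj _
    simp only [e]
    rw [integral_complex_ofReal, Complex.norm_real, Real.norm_eq_abs,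
      abs_of_nonneg (integral_nonneg fun _ => by positivity),
      integral_eq_lintegral_of_nonneg_ae (Eventually.of_forall fun _ => by positivity)
        (by have := hg.measurable; fun_prop)]
    simp [G, ENNReal.ofReal_pow]
  have key := norm_le_interp_of_mem_verticalClosedStrip₀₁' F (z := 1 / 2)
    (by simp [verticalClosedStrip]; norm_num) hFd hFb left right
  rw [mid, show ((1 / 2 : ℂ)).re = 1 / 2 by norm_num] at key
  have := le_four_mul_of_interpolation ENNReal.toReal_nonneg ENNReal.toReal_nonneg key
  rwa [← ENNReal.toReal_ofNat 4, ← ENNReal.toReal_mul,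
    ENNReal.toReal_le_toReal hG (by finiteness)] at this

end Contraction

/-! ### Splitting off the last cube variable; marginals and energies -/

variable {m : ℕ}

section Snoc

theorem measurePreserving_snoc :
    MeasurePreserving (fun p : Torus d × (Fin m → Torus d) =>
      (Fin.snoc p.2 p.1 : Fin (m + 1) → Torus d)) volume volume := by
  have h := (volume_preserving_piFinSuccAbove (fun _ : Fin (m + 1) => Torus d)
    (Fin.last m)).symm
  have e : ⇑(MeasurableEquiv.piFinSuccAbove (fun _ : Fin (m + 1) => Torus d) (Fin.last m)).symm
      = fun p : Torus d × (Fin m → Torus d) => (Fin.snoc p.2 p.1 : Fin (m + 1) → Torus d) := by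
    funext p
    exact Fin.insertNth_last' p.1 p.2
  rw [e] at h
  exact h

theorem measurable_snoc {X : Type*} [MeasurableSpace X] {f : X → Fin m → Torus d}
    {g : X → Torus d} (hf : Measurable f) (hg : Measurable g) :
    Measurable fun x => (Fin.snoc (f x) (g x) : Fin (m + 1) → Torus d) :=
  measurePreserving_snoc.measurable.comp (hg.prodMk hf)

theorem lintegral_snoc {G : (Fin (m + 1) → Torus d) → ℝ≥0∞} (hG : Measurable G) :
    ∫⁻ u, G u = ∫⁻ u', ∫⁻ v, G (Fin.snoc u' v) := by
  rw [← measurePreserving_snoc.lintegral_comp hG, Measure.volume_eq_prod,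
    lintegral_prod_symm (fun a : Torus d × (Fin m → Torus d) => G (Fin.snoc a.2 a.1))
      (hG.comp measurePreserving_snoc.measurable).aemeasurable]

theorem integral_snoc {G : (Fin (m + 1) → Torus d) → ℂ} (hG : IsBdd G) :
    ∫ u, G u = ∫ u', ∫ v, G (Fin.snoc u' v) := by
  have hs := measurePreserving_snoc (d := d) (m := m)
  rw [← hs.map_eq, integral_map hs.measurable.aemeasurable
    hG.measurable.aestronglyMeasurable, Measure.volume_eq_prod,
    integral_prod_symm _ ((hG.comp hs.measurable).integrable _)]

theorem prod_snoc {M : Type*} [CommMonoid M] (F : (Fin (m + 1) → Bool) → M) :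
    ∏ ι, F ι = (∏ ι : Fin m → Bool, F (Fin.snoc ι false))
      * ∏ ι : Fin m → Bool, F (Fin.snoc ι true) := by
  rw [← (Fin.snocEquiv (fun _ : Fin (m + 1) => Bool)).prod_comp, Fintype.prod_prod_type,
    Fintype.prod_bool, mul_comm]
  rfl

end Snoc

theorem measurable_init : Measurable fun u : Fin (m + 1) → Torus d => Fin.init u :=
  measurable_pi_lambda _ fun i => measurable_pi_apply i.castSucc

theorem IsBdd.cross {A B : Cube d m → ℂ} (hA : IsBdd A) (hB : IsBdd B) : IsBdd (cross A B) := by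
  have hi : Measurable fun p : Cube d (m + 1) => Fin.init p.2 :=
    measurable_init.comp measurable_snd
  refine (hA.comp (measurable_fst.prodMk hi)).mul (hB.comp (Measurable.prodMk ?_ hi)).star
  exact measurable_fst.sub ((measurable_pi_apply (Fin.last m)).comp measurable_snd)

theorem isBdd_deltaFun : ∀ (m : ℕ) {f : (Fin m → Bool) → Torus d → ℂ}, (∀ ι, IsBdd (f ι)) →
    IsBdd (deltaFun m f)
  | 0, _, hf => (hf _).comp measurable_fst
  | m + 1, _, hf => (isBdd_deltaFun m fun _ => hf _).cross (isBdd_deltaFun m fun _ => hf _)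

theorem cross_snoc (A B : Cube d m → ℂ) (x : Torus d) (u : Fin m → Torus d) (v : Torus d) :
    cross A B (x, Fin.snoc u v) = A (x, u) * conj (B (x - v, u)) := by
  simp [cross]

/-- The integral over the `x` variable. -/
noncomputable def marg (A : Cube d m → ℂ) (u : Fin m → Torus d) : ℂ := ∫ x, A (x, u)

theorem IsBdd.marg {A : Cube d m → ℂ} (hA : IsBdd A) : IsBdd (marg A) :=
  IsBdd.integral (F := fun p : (Fin m → Torus d) × Torus d => A (p.2, p.1))
    (hA.comp measurable_swap) volume

theorem marg_cross_snoc (A B : Cube d m → ℂ) (u : Fin m → Torus d) (v : Torus d) :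
    marg (cross A B) (Fin.snoc u v) = corr (fun x => A (x, u)) (fun x => B (x, u)) v := by
  simp only [marg, corr, cross_snoc]

theorem IsBdd.slice {A : Cube d m → ℂ} (hA : IsBdd A) (u : Fin m → Torus d) :
    IsBdd fun x => A (x, u) :=
  hA.comp measurable_prodMk_right

theorem integral_eq_integral_marg {A : Cube d m → ℂ} (hA : IsBdd A) :
    ∫ p, A p = ∫ u, marg A u := by
  rw [Measure.volume_eq_prod, integral_prod_symm _ (hA.integrable _)]; rfl

theorem coeff_zero (g : Torus d → ℂ) : coeff g 0 = ∫ x, g x := by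
  simp [coeff, UnitAddTorus.mFourier_zero]

theorem integral_cross {A B : Cube d m → ℂ} (hA : IsBdd A) (hB : IsBdd B) :
    ∫ p, cross A B p = ∫ u, marg A u * conj (marg B u) := by
  rw [integral_eq_integral_marg (hA.cross hB), integral_snoc (hA.cross hB).marg]
  refine integral_congr_ae (Eventually.of_forall fun u => ?_)
  -- The integral of a correlation is its coefficient at frequency `0`.
  have h := coeff_corr (hA.slice u) (hB.slice u) 0
  simp only [coeff_zero] at h
  simp only [marg_cross_snoc]
  exact h

/-- Partial Fourier coefficients in the `x` variable. -/
noncomputable def pcoeff (A : Cube d m → ℂ) (c : Fin d → ℤ) (u : Fin m → Torus d) : ℂ :=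
  coeff (fun x => A (x, u)) c

theorem IsBdd.pcoeff {A : Cube d m → ℂ} (hA : IsBdd A) (c : Fin d → ℤ) : IsBdd (pcoeff A c) :=
  IsBdd.integral (F := fun p : (Fin m → Torus d) × Torus d =>
    UnitAddTorus.mFourier (-c) p.2 * A (p.2, p.1))
    (((isBdd_mFourier _).comp measurable_snd).mul (hA.comp measurable_swap)) volume

/-- The energy `∫ ∑_c |Â(c; u)|² |B̂(c; u)|² du`. -/
noncomputable def energy (A B : Cube d m → ℂ) : ℝ≥0∞ :=
  ∫⁻ u, ∑' c, ‖pcoeff A c u‖ₑ ^ 2 * ‖pcoeff B c u‖ₑ ^ 2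

theorem lintegral_marg_cross {A B : Cube d m → ℂ} (hA : IsBdd A) (hB : IsBdd B) :
    ∫⁻ u, ‖marg (cross A B) u‖ₑ ^ 2 = energy A B := by
  rw [lintegral_snoc ((hA.cross hB).marg.measurable.enorm.pow_const 2)]
  refine lintegral_congr fun u => ?_
  simp only [marg_cross_snoc]
  exact lintegral_corr (hA.slice u) (hB.slice u)

theorem energy_le {A B : Cube d m → ℂ} (hA : IsBdd A) (hB : IsBdd B) :
    energy A B ≤ energy A A ^ (1 / 2 : ℝ) * energy B B ^ (1 / 2 : ℝ) := by
  have hm : ∀ {A : Cube d m → ℂ}, IsBdd A →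
      Measurable fun u => ∑' c, ‖pcoeff A c u‖ₑ ^ 2 * ‖pcoeff A c u‖ₑ ^ 2 := fun hA =>
    .tsum fun c => ((hA.pcoeff c).measurable.enorm.pow_const 2).mul
      ((hA.pcoeff c).measurable.enorm.pow_const 2)
  have hsq : ∀ x : ℝ≥0∞, (x ^ (1 / 2 : ℝ)) ^ 2 = x := fun x => by
    rw [← ENNReal.rpow_natCast, ← ENNReal.rpow_mul]; simp
  calc energy A B
      ≤ ∫⁻ u, (∑' c, ‖pcoeff A c u‖ₑ ^ 2 * ‖pcoeff A c u‖ₑ ^ 2) ^ (1 / 2 : ℝ)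
          * (∑' c, ‖pcoeff B c u‖ₑ ^ 2 * ‖pcoeff B c u‖ₑ ^ 2) ^ (1 / 2 : ℝ) := by
        refine lintegral_mono fun u => ?_
        -- Cauchy–Schwarz in the frequency `c`; a second application, in `u`, follows.
        have h := lintegral_mul_le_sqrt (m := Measure.count)
          (f := fun c : Fin d → ℤ => ‖pcoeff A c u‖ₑ ^ 2) (g := fun c => ‖pcoeff B c u‖ₑ ^ 2)
          (measurable_of_countable _).aemeasurable (measurable_of_countable _).aemeasurable
        simpa only [lintegral_count, sq (_ ^ 2)] using h
    _ ≤ _ := by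
        refine (lintegral_mul_le_sqrt ((hm hA).pow_const _).aemeasurable
          ((hm hB).pow_const _).aemeasurable).trans (le_of_eq ?_)
        simp only [hsq, energy]

/-! ### Gowers inner products and the Gowers–Cauchy–Schwarz inequality -/

/-- The integral of `Δ^m f`. -/
noncomputable def gowersInner (m : ℕ) (f : (Fin m → Bool) → Torus d → ℂ) : ℂ :=
  ∫ p, deltaFun m f p

/-- The square integral of `u ↦ ∫ Δ^m f(x; u) dx`. -/
noncomputable def margSq (m : ℕ) (f : (Fin m → Bool) → Torus d → ℂ) : ℝ≥0∞ :=
  ∫⁻ u, ‖marg (deltaFun m f) u‖ₑ ^ 2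

theorem enorm_gowersInner_succ_le {f : (Fin (m + 1) → Bool) → Torus d → ℂ}
    (hf : ∀ ι, IsBdd (f ι)) :
    ‖gowersInner (m + 1) f‖ₑ
      ≤ margSq m (half f false) ^ (1 / 2 : ℝ) * margSq m (half f true) ^ (1 / 2 : ℝ) := by
  have h : ∀ i, IsBdd (deltaFun m (half f i)) := fun i => isBdd_deltaFun m fun _ => hf _
  rw [gowersInner, deltaFun, integral_cross (h _) (h _)]
  refine (enorm_integral_le_lintegral_enorm _).trans ?_
  simp only [enorm_mul, RCLike.enorm_conj]
  exact lintegral_mul_le_sqrt (h _).marg.measurable.enorm.aemeasurable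
    (h _).marg.measurable.enorm.aemeasurable

theorem enorm_gowersInner_of_half_eq {f : (Fin (m + 1) → Bool) → Torus d → ℂ}
    {g : (Fin m → Bool) → Torus d → ℂ} (hg : ∀ ι, IsBdd (g ι)) (hf : ∀ i, half f i = g) :
    ‖gowersInner (m + 1) f‖ₑ = margSq m g := by
  have h := isBdd_deltaFun m hg
  rw [gowersInner, deltaFun, hf, hf, integral_cross h h, margSq]
  simp only [Complex.mul_conj']
  have e : ∀ u, ((‖marg (deltaFun m g) u‖ : ℂ)) ^ 2 = ((‖marg (deltaFun m g) u‖ ^ 2 : ℝ) : ℂ) :=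
    fun u => by push_cast; rfl
  simp only [e]
  rw [integral_complex_ofReal, ← ofReal_norm, Complex.norm_real, Real.norm_eq_abs,
    abs_of_nonneg (integral_nonneg fun _ => by positivity),
    ofReal_integral_eq_lintegral_ofReal ((h.marg.memLp volume 2).integrable_norm_pow (by norm_num))
      (Eventually.of_forall fun _ => by positivity)]
  simp [ENNReal.ofReal_pow]

/-- Thus `margSq m` of a constant family is the `2^{m+1}`-th power of its order `m + 1` uniformity
norm. -/
theorem enorm_gowersInner_const {a : Torus d → ℂ} (ha : IsBdd a) :
    ‖gowersInner (m + 1) (fun _ => a)‖ₑ = margSq m (fun _ => a) :=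
  enorm_gowersInner_of_half_eq (fun _ => ha) fun _ => rfl

theorem margSq_succ {f : (Fin (m + 1) → Bool) → Torus d → ℂ} (hf : ∀ ι, IsBdd (f ι)) :
    margSq (m + 1) f = energy (deltaFun m (half f false)) (deltaFun m (half f true)) :=
  lintegral_marg_cross (isBdd_deltaFun m fun _ => hf _) (isBdd_deltaFun m fun _ => hf _)

theorem margSq_const_succ {a : Torus d → ℂ} (ha : IsBdd a) :
    margSq (m + 1) (fun _ => a) = energy (deltaFun m fun _ => a) (deltaFun m fun _ => a) :=
  margSq_succ fun _ => ha

/-- The product `a · conj (b(· - v))`. -/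
noncomputable def twist (a b : Torus d → ℂ) (v x : Torus d) : ℂ := a x * conj (b (x - v))

theorem IsBdd.twist {a b : Torus d → ℂ} (ha : IsBdd a) (hb : IsBdd b) (v : Torus d) :
    IsBdd (twist a b v) :=
  ha.mul (hb.comp (measurable_sub_const v)).star

theorem deltaFun_twist (v : Torus d) : ∀ (m : ℕ) (f g : (Fin m → Bool) → Torus d → ℂ)
    (x : Torus d) (u : Fin m → Torus d), deltaFun m (fun ι => twist (f ι) (g ι) v) (x, u)
      = deltaFun m f (x, u) * conj (deltaFun m g (x - v, u))
  | 0, f, g, x, u => rfl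
  | m + 1, f, g, x, u => by
    have h := deltaFun_twist v m
    have e : ∀ i, half (fun ι => twist (f ι) (g ι) v) i
        = fun ι => twist (half f i ι) (half g i ι) v := fun i => rfl
    simp only [deltaFun, cross, e, h, map_mul, Complex.conj_conj]
    rw [sub_right_comm x v]
    ring

/-- For a fixed last variable `v`, the order `m + 1` product is an order `m` product of the twisted
functions. This is the induction step for Gowers–Cauchy–Schwarz. -/
theorem gowersInner_succ_eq_integral {f : (Fin (m + 1) → Bool) → Torus d → ℂ}
    (hf : ∀ ι, IsBdd (f ι)) :
    gowersInner (m + 1) f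
      = ∫ v, gowersInner m (fun ι => twist (half f false ι) (half f true ι) v) := by
  have h : ∀ i, IsBdd (deltaFun m (half f i)) := fun i => isBdd_deltaFun m fun _ => hf _
  have hc := ((h false).cross (h true)).marg
  rw [gowersInner, deltaFun, integral_eq_integral_marg ((h _).cross (h _)), integral_snoc hc,
    integral_swap_of_isBdd (F := fun (u : Fin m → Torus d) v => marg (cross _ _) (Fin.snoc u v))
      (hc.comp (measurable_snoc measurable_fst measurable_snd))]
  refine integral_congr_ae (Eventually.of_forall fun v => ?_)
  simp only [gowersInner]
  have ht : IsBdd (deltaFun m fun ι => twist (half f false ι) (half f true ι) v) :=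
    isBdd_deltaFun m fun ι => (hf _).twist (hf _) v
  rw [integral_eq_integral_marg ht]
  refine integral_congr_ae (Eventually.of_forall fun u => ?_)
  simp only [marg, cross_snoc, deltaFun_twist]

theorem marg_twist (v : Torus d) (f g : (Fin m → Bool) → Torus d → ℂ) (u : Fin m → Torus d) :
    marg (deltaFun m fun ι => twist (f ι) (g ι) v) u
      = marg (cross (deltaFun m f) (deltaFun m g)) (Fin.snoc u v) := by
  simp only [marg, cross_snoc, deltaFun_twist]

theorem measurable_margSq_twist {a b : Torus d → ℂ} (ha : IsBdd a) (hb : IsBdd b) :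
    Measurable fun v => margSq m (fun _ => twist a b v) := by
  have hc : IsBdd (marg (cross (deltaFun m fun _ => a) (deltaFun m fun _ => b))) :=
    ((isBdd_deltaFun m fun _ => ha).cross (isBdd_deltaFun m fun _ => hb)).marg
  have e : ∀ v u, marg (deltaFun m fun _ => twist a b v) u
      = marg (cross (deltaFun m fun _ => a) (deltaFun m fun _ => b)) (Fin.snoc u v) :=
    fun v u => marg_twist v (fun _ => a) (fun _ => b) u
  simp only [margSq, e]
  exact Measurable.lintegral_prod_right'
    (f := fun p : Torus d × (Fin m → Torus d) => ‖marg (cross (deltaFun m fun _ => a)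
      (deltaFun m fun _ => b)) (Fin.snoc p.2 p.1)‖ₑ ^ 2)
    ((hc.comp (measurable_snoc measurable_snd measurable_fst)).measurable.enorm.pow_const 2)

theorem lintegral_margSq_twist {a b : Torus d → ℂ} (ha : IsBdd a) (hb : IsBdd b) :
    ∫⁻ v, margSq m (fun _ => twist a b v)
      = energy (deltaFun m fun _ => a) (deltaFun m fun _ => b) := by
  have hA : IsBdd (deltaFun m fun _ => a) := isBdd_deltaFun m fun _ => ha
  have hB : IsBdd (deltaFun m fun _ => b) := isBdd_deltaFun m fun _ => hb
  have e : ∀ v u, marg (deltaFun m fun _ => twist a b v) u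
      = marg (cross (deltaFun m fun _ => a) (deltaFun m fun _ => b)) (Fin.snoc u v) :=
    fun v u => marg_twist v (fun _ => a) (fun _ => b) u
  have hm := (hA.cross hB).marg.measurable.enorm.pow_const 2
  rw [← lintegral_marg_cross hA hB, lintegral_snoc hm, lintegral_lintegral_swap]
  · simp only [margSq, e]
  · exact (hm.comp (measurable_snoc measurable_fst measurable_snd)).aemeasurable

/-- The Gowers–Cauchy–Schwarz inequality. -/
theorem gowers_cauchy_schwarz : ∀ (m : ℕ) {f : (Fin (m + 1) → Bool) → Torus d → ℂ},
    (∀ ι, IsBdd (f ι)) →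
    ‖gowersInner (m + 1) f‖ₑ ≤ ∏ ι, margSq m (fun _ => f ι) ^ ((1 : ℝ) / 2 ^ (m + 1))
  | 0, f, hf => by
    refine (enorm_gowersInner_succ_le hf).trans (le_of_eq ?_)
    have e : ∀ i, half f i = fun _ => f (Fin.snoc default i) := fun i =>
      funext fun ι => by rw [half, Subsingleton.elim ι default]
    rw [prod_snoc, Fintype.prod_unique, Fintype.prod_unique, e, e]
    simp only [Subsingleton.elim _ (default : Fin 0 → Bool)]
    norm_num
  | m + 1, f, hf => by
    have hp : ∑ _ι : Fin (m + 1) → Bool, (1 : ℝ) / 2 ^ (m + 1) = 1 := by simp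
    rw [gowersInner_succ_eq_integral hf]
    calc _ ≤ ∫⁻ v, ‖gowersInner (m + 1)
              (fun ι => twist (half f false ι) (half f true ι) v)‖ₑ :=
            enorm_integral_le_lintegral_enorm _
      _ ≤ ∫⁻ v, ∏ ι : Fin (m + 1) → Bool, margSq m (fun _ => twist (half f false ι)
              (half f true ι) v) ^ ((1 : ℝ) / 2 ^ (m + 1)) :=
            lintegral_mono fun v => gowers_cauchy_schwarz m fun ι => (hf _).twist (hf _) v
      -- Hölder with `2^{m+1}` factors, each of exponent `2^{m+1}`.
      _ ≤ ∏ ι : Fin (m + 1) → Bool, (∫⁻ v, margSq m (fun _ => twist (half f false ι)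
              (half f true ι) v)) ^ ((1 : ℝ) / 2 ^ (m + 1)) :=
            ENNReal.lintegral_prod_norm_pow_le _
              (fun ι _ => (measurable_margSq_twist (hf _) (hf _)).aemeasurable) hp
              fun _ _ => by positivity
      -- The integral over `v` is a mixed energy of two constant families, which `energy_le`
      -- separates.
      _ ≤ ∏ ι : Fin (m + 1) → Bool, (margSq (m + 1) (fun _ => half f false ι) ^ (1 / 2 : ℝ)
              * margSq (m + 1) (fun _ => half f true ι) ^ (1 / 2 : ℝ))
                ^ ((1 : ℝ) / 2 ^ (m + 1)) := by
            refine Finset.prod_le_prod' fun ι _ => ENNReal.rpow_le_rpow ?_ (by positivity)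
            have h : ∀ i, IsBdd (half f i ι) := fun i => hf _
            rw [lintegral_margSq_twist (h _) (h _), margSq_const_succ (h _),
              margSq_const_succ (h _)]
            exact energy_le (isBdd_deltaFun _ fun _ => h _) (isBdd_deltaFun _ fun _ => h _)
      _ = _ := by
            rw [prod_snoc (m := m + 1) (fun ι => margSq (m + 1) (fun _ => f ι) ^ _),
              ← Finset.prod_mul_distrib]
            refine Finset.prod_congr rfl fun ι _ => ?_
            rw [ENNReal.mul_rpow_of_nonneg _ _ (by positivity), ← ENNReal.rpow_mul,
              ← ENNReal.rpow_mul, show (1 / 2 : ℝ) * (1 / 2 ^ (m + 1)) = 1 / 2 ^ (m + 1 + 1) by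
                rw [pow_succ _ (m + 1)]; field_simp]
            rfl

/-! ### From Fourier sums to energies, and from energies to uniformity norms -/

theorem tsum_fourier_cross_le {A B : Cube d m → ℂ} (hA : IsBdd A) (hB : IsBdd B) :
    ∑' η : Fin (m + 1) → Fin d → ℤ, ‖∫ p : Cube d (m + 1), (UnitAddTorus.mFourier (-0) p.1
      * ∏ i, UnitAddTorus.mFourier (-(η i)) (p.2 i)) * cross A B p‖ₑ ^ 2 ≤ energy A B := by
  have hc := hA.cross hB
  have hχ : ∀ η : Fin (m + 1) → Fin d → ℤ, IsBdd fun u : Fin (m + 1) → Torus d =>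
      ∏ i, UnitAddTorus.mFourier (-(η i)) (u i) := fun η =>
    IsBdd.prod _ fun i _ => (isBdd_mFourier _).comp (measurable_pi_apply i)
  have e : ∀ η : Fin (m + 1) → Fin d → ℤ, ∫ p : Cube d (m + 1), (UnitAddTorus.mFourier (-0) p.1
      * ∏ i, UnitAddTorus.mFourier (-(η i)) (p.2 i)) * cross A B p
      = ∫ u, (∏ i, UnitAddTorus.mFourier (-(η i)) (u i)) * marg (cross A B) u := fun η => by
    simp only [neg_zero, UnitAddTorus.mFourier_zero, ContinuousMap.one_apply, one_mul]
    rw [integral_eq_integral_marg (((hχ η).comp measurable_snd).mul hc)]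
    simp only [marg, integral_const_mul]
  simp only [e]
  rw [← lintegral_marg_cross hA hB]
  exact bessel hc.marg

theorem energy_self (A : Cube d m → ℂ) : energy A A = ∫⁻ u, ∑' c, ‖pcoeff A c u‖ₑ ^ 4 := by
  simp only [energy, ← pow_add]

theorem energy_self_eq_tsum {A : Cube d m → ℂ} (hA : IsBdd A) :
    energy A A = ∑' c, ∫⁻ u, ‖pcoeff A c u‖ₑ ^ 4 := by
  rw [energy_self, lintegral_tsum fun c => ((hA.pcoeff c).measurable.enorm.pow_const 4).aemeasurable]

/-- Extend `f` to a family of order `m + 2` that ignores its last two indices: the energy is the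
modulus of its Gowers inner product. Each `f ι` occurs four times there, whence the fourth power. -/
theorem energy_deltaFun_self_le {f : (Fin m → Bool) → Torus d → ℂ} (hf : ∀ ι, IsBdd (f ι)) :
    energy (deltaFun m f) (deltaFun m f)
      ≤ (∏ ι, ‖gowersInner (m + 2) (fun _ => f ι)‖ₑ ^ ((1 : ℝ) / 2 ^ (m + 2))) ^ 4 := by
  let g : (Fin (m + 1) → Bool) → Torus d → ℂ := fun ι => f (Fin.init ι)
  let h : (Fin (m + 2) → Bool) → Torus d → ℂ := fun ι => g (Fin.init ι)
  have hg : ∀ i, half g i = f := fun i => funext fun ι => by simp [half, g]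
  have hh : ∀ i, half h i = g := fun i => funext fun ι => by simp [half, h]
  have e1 : energy (deltaFun m f) (deltaFun m f) = margSq (m + 1) g := by
    rw [margSq_succ (fun _ => hf _), hg, hg]
  rw [e1, ← enorm_gowersInner_of_half_eq (fun _ => hf _) hh]
  refine (gowers_cauchy_schwarz (m + 1) fun _ => hf _).trans (le_of_eq ?_)
  simp only [← enorm_gowersInner_const (hf _)]
  rw [prod_snoc, prod_snoc, prod_snoc]
  simp only [Fin.init_snoc]
  ring

/-! ### Effect of the high-pass operators on energies -/

section HighPass

variable (φ : C(Torus d, ℝ))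

theorem partialConv_last (A : Cube d m → ℂ) (p : Cube d m) :
    partialConv φ (Fin.last m) A p = ∫ y, (φ y : ℂ) * A (p.1 - y, p.2) := by
  simp [partialConv]

theorem partialConv_castSucc (i : Fin m) (A : Cube d m → ℂ) (p : Cube d m) :
    partialConv φ i.castSucc A p
      = ∫ y, (φ y : ℂ) * A (p.1, Function.update p.2 i (p.2 i - y)) := by
  simp [partialConv]

theorem measurable_update_sub (i : Fin m) :
    Measurable fun q : (Fin m → Torus d) × Torus d => Function.update q.1 i (q.1 i - q.2) := by
  have hi : Measurable fun q : (Fin m → Torus d) × Torus d => q.1 i :=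
    (measurable_pi_apply i).comp measurable_fst
  refine measurable_pi_lambda _ fun l => ?_
  rcases eq_or_ne l i with rfl | hl
  · simp only [Function.update_self]
    exact hi.sub measurable_snd
  · simp only [Function.update_of_ne hl]
    exact (measurable_pi_apply l).comp measurable_fst

theorem IsBdd.highPass {A : Cube d m → ℂ} (hA : IsBdd A) (j : Fin (m + 1)) :
    IsBdd (highPass φ j A) := by
  have hK : IsBdd fun q : Cube d m × Torus d => (φ q.2 : ℂ) := (isBdd_kernel φ).comp measurable_snd
  refine hA.sub ?_
  refine Fin.lastCases ?_ (fun i => ?_) j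
  · rw [funext (partialConv_last φ A)]
    refine IsBdd.integral (F := fun q : Cube d m × Torus d => (φ q.2 : ℂ) * A (q.1.1 - q.2, q.1.2))
      (hK.mul (hA.comp (Measurable.prodMk ?_ ?_))) volume
    · exact (measurable_fst.comp measurable_fst).sub measurable_snd
    · exact measurable_snd.comp measurable_fst
  · rw [funext (partialConv_castSucc φ i A)]
    refine IsBdd.integral (F := fun q : Cube d m × Torus d =>
      (φ q.2 : ℂ) * A (q.1.1, Function.update q.1.2 i (q.1.2 i - q.2)))
      (hK.mul (hA.comp (Measurable.prodMk ?_ ?_))) volume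
    · exact measurable_fst.comp measurable_fst
    · exact (measurable_update_sub i).comp
        ((measurable_snd.comp measurable_fst).prodMk measurable_snd)

theorem pcoeff_highPass_last (A : Cube d m → ℂ) (c : Fin d → ℤ) (u : Fin m → Torus d) :
    pcoeff (highPass φ (Fin.last m) A) c u = coeff (convCompl φ fun x => A (x, u)) c := by
  simp only [pcoeff, highPass, partialConv_last]
  rfl

/-- By Fubini, a Fourier coefficient in `x` commutes with convolution in `u_i`. -/
theorem pcoeff_highPass_castSucc {A : Cube d m → ℂ} (hA : IsBdd A) (i : Fin m) (c : Fin d → ℤ)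
    (u : Fin m → Torus d) :
    pcoeff (highPass φ i.castSucc A) c u
      = pcoeff A c u - ∫ y, (φ y : ℂ) * pcoeff A c (Function.update u i (u i - y)) := by
  have hχ := isBdd_mFourier (-c)
  have hu : Measurable fun q : Torus d × Torus d => Function.update u i (u i - q.2) :=
    (measurable_update_sub i).comp (measurable_const.prodMk measurable_snd)
  have hK : IsBdd fun q : Torus d × Torus d =>
      (φ q.2 : ℂ) * A (q.1, Function.update u i (u i - q.2)) :=
    ((isBdd_kernel φ).comp measurable_snd).mul (hA.comp (measurable_fst.prodMk hu))
  have hI : IsBdd fun x => ∫ y, (φ y : ℂ) * A (x, Function.update u i (u i - y)) :=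
    hK.integral volume
  simp only [pcoeff, coeff, highPass, partialConv_castSucc, mul_sub]
  rw [integral_sub ((hχ.mul (hA.slice u)).integrable _) ((hχ.mul hI).integrable _)]
  congr 1
  simp only [← integral_const_mul]
  rw [integral_swap_of_isBdd (F := fun x y : Torus d => UnitAddTorus.mFourier (-c) x *
    ((φ y : ℂ) * A (x, Function.update u i (u i - y)))) ((hχ.comp measurable_fst).mul hK)]
  simp only [mul_left_comm]

variable {φ} (hφ : IsCutoffKernel φ)
include hφ

theorem IsCutoffKernel.lintegral_update_pow_four_le {b : (Fin m → Torus d) → ℂ} (hb : IsBdd b)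
    (i : Fin m) :
    ∫⁻ u, ‖b u - ∫ y, (φ y : ℂ) * b (Function.update u i (u i - y))‖ₑ ^ 4
      ≤ 4 * ∫⁻ u, ‖b u‖ₑ ^ 4 := by
  have hs : Measurable fun q : (Fin m → Torus d) × Torus d =>
      q.1 + (Pi.single i q.2 : Fin m → Torus d) := by
    refine measurable_pi_lambda _ fun l => ?_
    have hl : Measurable fun q : (Fin m → Torus d) × Torus d => q.1 l :=
      (measurable_pi_apply l).comp measurable_fst
    rcases eq_or_ne l i with rfl | h
    · simp only [Pi.add_apply, Pi.single_eq_same]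
      exact hl.add measurable_snd
    · simpa [Pi.single_eq_of_ne h] using hl
  -- Averaging over translates along the `i`-th axis reduces the bound to the one-variable estimate
  -- on each line.
  have avg : ∀ {H : (Fin m → Torus d) → ℝ≥0∞}, Measurable H →
      ∫⁻ u, H u = ∫⁻ u, ∫⁻ t : Torus d, H (u + (Pi.single i t : Fin m → Torus d)) :=
      fun {H} hH => by
    rw [lintegral_lintegral_swap (f := fun u (t : Torus d) =>
      H (u + (Pi.single i t : Fin m → Torus d))) (hH.comp hs).aemeasurable]
    simp [lintegral_add_right_eq_self]
  have hB : IsBdd fun u => b u - ∫ y, (φ y : ℂ) * b (Function.update u i (u i - y)) :=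
    hb.sub (IsBdd.integral (F := fun q : (Fin m → Torus d) × Torus d =>
      (φ q.2 : ℂ) * b (Function.update q.1 i (q.1 i - q.2)))
      (((isBdd_kernel φ).comp measurable_snd).mul (hb.comp (measurable_update_sub i))) volume)
  rw [avg (hB.measurable.enorm.pow_const 4), avg (hb.measurable.enorm.pow_const 4),
    ← lintegral_const_mul' _ _ (by simp)]
  refine lintegral_mono fun u => ?_
  have hsl : IsBdd fun t : Torus d => b (u + (Pi.single i t : Fin m → Torus d)) :=
    hb.comp (hs.comp (measurable_const.prodMk measurable_id))
  have e : ∀ t y : Torus d, Function.update (u + Pi.single i t : Fin m → Torus d) i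
      ((u + Pi.single i t : Fin m → Torus d) i - y)
      = u + (Pi.single i (t - y) : Fin m → Torus d) := fun t y => by
    ext1 l
    rcases eq_or_ne l i with rfl | h
    · simp [add_sub_assoc]
    · simp [h]
  simp only [e]
  exact hφ.lintegral_pow_four_le hsl

/-- Frequency by frequency: the multiplier `1 - φ̂(c)` when the variable is `x` (constant `1` would
do), the `L⁴` bound when it is some `u_i`. -/
theorem IsCutoffKernel.energy_highPass_le {A : Cube d m → ℂ} (hA : IsBdd A) (j : Fin (m + 1)) :
    energy (highPass φ j A) (highPass φ j A) ≤ 4 * energy A A := by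
  rw [energy_self_eq_tsum (hA.highPass φ j), energy_self_eq_tsum hA, ← ENNReal.tsum_mul_left]
  refine ENNReal.tsum_le_tsum fun c => ?_
  refine Fin.lastCases ?_ (fun i => ?_) j
  · simp only [pcoeff_highPass_last]
    refine le_trans (lintegral_mono fun u => pow_le_pow_left'
      (hφ.enorm_coeff_convCompl_le (hA.slice u) c) 4) (le_mul_of_one_le_left' (by norm_num))
  · simp only [pcoeff_highPass_castSucc φ hA]
    exact hφ.lintegral_update_pow_four_le (hA.pcoeff c) i

end HighPass

/-! ### The two inequalities for bounded functions -/

theorem ENNReal_rpow_half_pow_four (x : ℝ≥0∞) : (x ^ 4) ^ (1 / 2 : ℝ) = x ^ 2 := by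
  rw [← ENNReal.rpow_natCast, ← ENNReal.rpow_mul, ← ENNReal.rpow_natCast]
  norm_num

theorem ENNReal_rpow_half_four : (4 : ℝ≥0∞) ^ (1 / 2 : ℝ) = 2 := by
  rw [show (4 : ℝ≥0∞) = 2 ^ (2 : ℝ) by rw [ENNReal.rpow_two]; norm_num, ← ENNReal.rpow_mul]
  norm_num

section FunctionLevel

variable {φ : C(Torus d, ℝ)} (hφ : IsCutoffKernel φ) (j : Fin (k + 1))
  {f : (Fin (k + 1) → Bool) → Torus d → ℂ} (hf : ∀ ι, IsBdd (f ι))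
include hf

/-- The bound for `cross A B` when the energies of `A`, `B` are at most those of the `Δ^k` of the
two halves of `f`, up to constants. -/
theorem tsum_fourier_cross_le_prod {A B : Cube d k → ℂ} (hA : IsBdd A) (hB : IsBdd B) {a b : ℝ≥0∞}
    (ha : energy A A ≤ a * energy (deltaFun k (half f false)) (deltaFun k (half f false)))
    (hb : energy B B ≤ b * energy (deltaFun k (half f true)) (deltaFun k (half f true))) :
    ∑' η : Fin (k + 1) → Fin d → ℤ, ‖∫ p : Cube d (k + 1), (UnitAddTorus.mFourier (-0) p.1
      * ∏ i, UnitAddTorus.mFourier (-(η i)) (p.2 i)) * cross A B p‖ₑ ^ 2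
    ≤ a ^ (1 / 2 : ℝ) * b ^ (1 / 2 : ℝ) *
      ∏ ι, (‖gowersInner (k + 2) (fun _ => f ι)‖ₑ ^ ((1 : ℝ) / 2 ^ (k + 2))) ^ 2 := by
  have h : ∀ {A : Cube d k → ℂ} {a : ℝ≥0∞} (i : Bool),
      energy A A ≤ a * energy (deltaFun k (half f i)) (deltaFun k (half f i)) →
      energy A A ^ (1 / 2 : ℝ) ≤ a ^ (1 / 2 : ℝ) * ∏ ι : Fin k → Bool,
        (‖gowersInner (k + 2) (fun _ => f (Fin.snoc ι i))‖ₑ ^ ((1 : ℝ) / 2 ^ (k + 2))) ^ 2 := by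
    intro A a i hi
    have := hi.trans (mul_le_mul_right (energy_deltaFun_self_le (f := half f i) fun _ => hf _) a)
    refine (ENNReal.rpow_le_rpow this (by norm_num : (0 : ℝ) ≤ 1 / 2)).trans (le_of_eq ?_)
    rw [ENNReal.mul_rpow_of_nonneg _ _ (by norm_num), ENNReal_rpow_half_pow_four,
      ← Finset.prod_pow]
    rfl
  refine (tsum_fourier_cross_le hA hB).trans ((energy_le hA hB).trans
    ((mul_le_mul' (h false ha) (h true hb)).trans (le_of_eq ?_)))
  rw [prod_snoc, mul_mul_mul_comm]

include hφ

theorem tsum_fourier_deltaFunHighBoth_le :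
    ∑' η : Fin (k + 1) → Fin d → ℤ, ‖∫ p : Cube d (k + 1), (UnitAddTorus.mFourier (-0) p.1
      * ∏ i, UnitAddTorus.mFourier (-(η i)) (p.2 i)) * deltaFunHighBoth φ j f p‖ₑ ^ 2
    ≤ 16 * ∏ ι, (‖gowersInner (k + 2) (fun _ => f ι)‖ₑ ^ ((1 : ℝ) / 2 ^ (k + 2))) ^ 2 := by
  have h : ∀ i, IsBdd (deltaFun k (half f i)) := fun i => isBdd_deltaFun k fun _ => hf _
  refine (tsum_fourier_cross_le_prod hf ((h _).highPass φ j) ((h _).highPass φ j)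
    (hφ.energy_highPass_le (h _) j) (hφ.energy_highPass_le (h _) j)).trans ?_
  rw [ENNReal_rpow_half_four]
  -- The argument gives the constant `2 * 2 = 4`, weakened here to `16`.
  gcongr
  norm_num

theorem tsum_fourier_deltaFunHighRight_le :
    ∑' η : Fin (k + 1) → Fin d → ℤ, ‖∫ p : Cube d (k + 1), (UnitAddTorus.mFourier (-0) p.1
      * ∏ i, UnitAddTorus.mFourier (-(η i)) (p.2 i)) * deltaFunHighRight φ j f p‖ₑ ^ 2
    ≤ 2 * ∏ ι, (‖gowersInner (k + 2) (fun _ => f ι)‖ₑ ^ ((1 : ℝ) / 2 ^ (k + 2))) ^ 2 := by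
  have h : ∀ i, IsBdd (deltaFun k (half f i)) := fun i => isBdd_deltaFun k fun _ => hf _
  refine (tsum_fourier_cross_le_prod hf (h _) ((h _).highPass φ j)
    (one_mul _).ge (hφ.energy_highPass_le (h _) j)).trans ?_
  rw [ENNReal_rpow_half_four, ENNReal.one_rpow, one_mul]

end FunctionLevel

/-! ### Complex measures and their mollifications -/

section CIntegral

variable {X : Type*} [MeasurableSpace X] (μ : ComplexMeasure X)

theorem cintegral_const_mul (c : ℂ) (f : X → ℂ) :
    cintegral μ (fun x => c * f x) = c * cintegral μ f := by
  refine setToFun_smul (𝕜 := ℂ) _ (fun c s x => ?_) c f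
  change ContinuousLinearMap.mul ℝ ℂ (c • x) (μ s) = c • ContinuousLinearMap.mul ℝ ℂ x (μ s)
  simp [mul_assoc]

theorem cintegral_sum {ι : Type*} (s : Finset ι) {f : ι → X → ℂ} (hf : ∀ i ∈ s, IsBdd (f i)) :
    cintegral μ (fun x => ∑ i ∈ s, f i x) = ∑ i ∈ s, cintegral μ (f i) :=
  VectorMeasure.integral_finsetSum s fun i hi => (hf i hi).integrable _

theorem cintegral_one : cintegral μ (fun _ => 1) = μ Set.univ := by
  simp [cintegral]

theorem cintegral_zero_measure (f : X → ℂ) : cintegral 0 f = 0 :=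
  VectorMeasure.integral_zero_vectorMeasure ..

end CIntegral

/-- Fourier coefficients of a complex measure on the torus. -/
noncomputable def measureCoeff (μ : ComplexMeasure (Torus d)) (c : Fin d → ℤ) : ℂ :=
  cintegral μ fun y => UnitAddTorus.mFourier (-c) y

theorem IsFrequencyCutoff.isCutoffKernel {φ : ℕ → C(Torus d, ℝ)} (hφ : IsFrequencyCutoff φ)
    (n : ℕ) : IsCutoffKernel (φ n) :=
  ⟨hφ.nonneg n, hφ.integral_eq_one n, hφ.coeff_mem n⟩

theorem kernel_eq_sum {K : C(Torus d, ℝ)} (h : {c | kernelCoeff K c ≠ 0}.Finite) (x : Torus d) :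
    (K x : ℂ) = ∑ c ∈ h.toFinset, kernelCoeff K c * UnitAddTorus.mFourier c x := by
  let g : C(Torus d, ℂ) := ⟨fun x => (K x : ℂ), by fun_prop⟩
  have hc : ∀ c, UnitAddTorus.mFourierCoeff g c = kernelCoeff K c := fun c =>
    mFourierCoeff_eq_coeff g c
  have hs : Summable (UnitAddTorus.mFourierCoeff g) :=
    summable_of_ne_finset_zero (s := h.toFinset) fun c hc' => by
      rw [hc]; simpa using hc'
  have := (UnitAddTorus.hasSum_mFourier_series_apply_of_summable hs x).unique
    (hasSum_sum_of_ne_finset_zero (s := h.toFinset) fun c hc' => by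
      have : kernelCoeff K c = 0 := by simpa using hc'
      rw [hc, this, zero_smul])
  simp only [hc, smul_eq_mul] at this
  exact this

/-- The kernel is a finite sum of characters, so finite additivity of the integral against `μ`
suffices. -/
theorem mollify_eq_sum {K : C(Torus d, ℝ)} (h : {c | kernelCoeff K c ≠ 0}.Finite)
    (μ : ComplexMeasure (Torus d)) (x : Torus d) :
    mollify K μ x = ∑ c ∈ h.toFinset,
      kernelCoeff K c * measureCoeff μ c * UnitAddTorus.mFourier c x := by
  have e : ∀ y, (K (x - y) : ℂ) = ∑ c ∈ h.toFinset,
      (kernelCoeff K c * UnitAddTorus.mFourier c x) * UnitAddTorus.mFourier (-c) y := fun y => by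
    rw [kernel_eq_sum h]
    simp only [mFourier_sub_apply, mul_assoc]
  simp only [mollify, e]
  rw [cintegral_sum _ _ fun c _ => (IsBdd.const _).mul (isBdd_mFourier (-c))]
  refine Finset.sum_congr rfl fun c _ => ?_
  rw [cintegral_const_mul, ← measureCoeff]
  ring

theorem isBdd_mollify {K : C(Torus d, ℝ)} (h : {c | kernelCoeff K c ≠ 0}.Finite)
    (μ : ComplexMeasure (Torus d)) : IsBdd (mollify K μ) := by
  rw [funext (mollify_eq_sum h μ)]
  exact .of_continuous (by fun_prop)

theorem coeff_mollify {K : C(Torus d, ℝ)} (h : {c | kernelCoeff K c ≠ 0}.Finite)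
    (μ : ComplexMeasure (Torus d)) (ξ : Fin d → ℤ) :
    coeff (mollify K μ) ξ = kernelCoeff K ξ * measureCoeff μ ξ := by
  simp only [coeff, mollify_eq_sum h, Finset.mul_sum]
  rw [integral_finsetSum _ fun c _ => ((isBdd_mFourier _).mul
    ((IsBdd.const _).mul (isBdd_mFourier c))).integrable _]
  have e : ∀ c, ∫ x, UnitAddTorus.mFourier (-ξ) x * (kernelCoeff K c * measureCoeff μ c *
      UnitAddTorus.mFourier c x) = if c = ξ then kernelCoeff K c * measureCoeff μ c else 0 := by
    intro c
    have := integral_mFourier (-ξ + c)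
    simp only [neg_add_eq_zero, UnitAddTorus.mFourier_add] at this
    simp only [mul_left_comm, integral_const_mul, this, eq_comm (a := ξ)]
    simp
  simp only [e, Finset.sum_ite_eq', Set.Finite.mem_toFinset, Set.mem_ofPred_eq]
  split_ifs with h0
  · rfl
  · rw [not_not.mp h0, zero_mul]

theorem tendsto_kernelCoeff {K : ℕ → C(Torus d, ℝ)} (hK : IsApproxIdentity K) (c : Fin d → ℤ) :
    Tendsto (fun n => kernelCoeff (K n) c) atTop (𝓝 1) := by
  rw [tendsto_iff_norm_sub_tendsto_zero, Metric.tendsto_atTop]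
  intro ε hε
  let e := UnitAddTorus.mFourier (-c)
  -- The error is at most `ε / 2` from `U`, plus twice a tail mass that is eventually below `ε / 4`.
  let U : Set (Torus d) := {x | ‖e x - 1‖ < ε / 2}
  have hUo : IsOpen U := isOpen_lt (by fun_prop) continuous_const
  have hU : U ∈ 𝓝 (0 : Torus d) := hUo.mem_nhds (by
    have : e 0 = 1 := by simp [e, UnitAddTorus.mFourier]
    simp [U, this, hε])
  obtain ⟨n₀, hn₀⟩ := Metric.tendsto_atTop.mp (hK.concentrates U hU) (ε / 4) (by positivity)
  refine ⟨n₀, fun n hn => ?_⟩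
  have hint : Integrable (K n : Torus d → ℝ) :=
    (K n).continuous.integrable_of_hasCompactSupport (.of_compactSpace _)
  have h1 : kernelCoeff (K n) c - 1 = ∫ x, (e x - 1) * (K n x : ℂ) := by
    have h2 : ∫ x, (K n x : ℂ) = 1 := by
      rw [integral_complex_ofReal, hK.integral_eq_one, Complex.ofReal_one]
    simp only [sub_mul, one_mul]
    rw [integral_sub (((isBdd_mFourier _).mul (isBdd_kernel _)).integrable _)
      ((isBdd_kernel _).integrable _), h2]
    rfl
  have h3 : ‖∫ x, (e x - 1) * (K n x : ℂ)‖
      ≤ ∫ x, (ε / 2 * K n x + 2 * Uᶜ.indicator (K n) x) := by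
    refine norm_integral_le_of_norm_le ((hint.const_mul _).add
      ((hint.indicator hUo.measurableSet.compl).const_mul _)) (Eventually.of_forall fun x => ?_)
    have hx := hK.nonneg n x
    rw [norm_mul, Complex.norm_real, Real.norm_eq_abs, abs_of_nonneg hx]
    by_cases hxU : x ∈ U
    · rw [Set.indicator_of_notMem (by simpa using hxU), mul_zero, add_zero]
      exact mul_le_mul_of_nonneg_right (le_of_lt hxU) hx
    · rw [Set.indicator_of_mem (by simpa using hxU)]
      have : ‖e x - 1‖ ≤ 2 := by
        refine (norm_sub_le _ _).trans ?_
        rw [norm_mFourier_apply, norm_one]; norm_num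
      nlinarith
  rw [integral_add (hint.const_mul _) ((hint.indicator hUo.measurableSet.compl).const_mul _),
    integral_const_mul, integral_const_mul, hK.integral_eq_one,
    integral_indicator hUo.measurableSet.compl] at h3
  have h4 := hn₀ n hn
  rw [Real.dist_eq, sub_zero] at h4 ⊢
  rw [abs_of_nonneg (norm_nonneg _), h1]
  have := (abs_lt.mp h4).2
  linarith

/-! ### Uniformity norms control Fourier coefficients -/

theorem deltaFun_const_zero : ∀ m, deltaFun (d := d) m (fun _ => 0) = 0
  | 0 => rfl
  | m + 1 => by
    have h := deltaFun_const_zero m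
    funext p
    change cross (deltaFun m fun _ => 0) (deltaFun m fun _ => 0) p = 0
    simp [cross, h]

/-- Monotonicity of the uniformity norms: Cauchy–Schwarz against `1` on a probability space. -/
theorem margSq_const_sq_le {a : Torus d → ℂ} (ha : IsBdd a) :
    margSq m (fun _ => a) ^ 2 ≤ margSq (m + 1) (fun _ => a) := by
  have h := isBdd_deltaFun (m + 1) (f := fun _ => a) fun _ => ha
  rw [← enorm_gowersInner_const ha, gowersInner, integral_eq_integral_marg h]
  have h1 : ‖∫ u, marg (deltaFun (m + 1) fun _ => a) u‖ₑ
      ≤ margSq (m + 1) (fun _ => a) ^ (1 / 2 : ℝ) := by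
    refine (enorm_integral_le_lintegral_enorm _).trans ?_
    simpa [margSq] using lintegral_mul_le_sqrt (m := volume) h.marg.measurable.enorm.aemeasurable
      (measurable_const (a := (1 : ℝ≥0∞))).aemeasurable
  refine (pow_le_pow_left' h1 2).trans (le_of_eq ?_)
  rw [← ENNReal.rpow_natCast, ← ENNReal.rpow_mul]
  simp

theorem margSq_one_pow_le {a : Torus d → ℂ} (ha : IsBdd a) :
    ∀ m, margSq 1 (fun _ => a) ^ (2 ^ m) ≤ margSq (m + 1) (fun _ => a)
  | 0 => by simp
  | m + 1 => by
    rw [pow_succ, pow_mul]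
    exact (pow_le_pow_left' (margSq_one_pow_le ha m) 2).trans (margSq_const_sq_le ha)

/-- The order two norm is the `ℓ⁴` norm of the Fourier coefficients, so it dominates each of them.
-/
theorem enorm_coeff_pow_four_le {a : Torus d → ℂ} (ha : IsBdd a) (c : Fin d → ℤ) :
    ‖coeff a c‖ₑ ^ 4 ≤ margSq 1 (fun _ => a) := by
  rw [margSq_const_succ ha, energy_self]
  have e : ∀ u : Fin 0 → Torus d, pcoeff (deltaFun 0 fun _ => a) c u = coeff a c := fun u => rfl
  calc ‖coeff a c‖ₑ ^ 4 = ∫⁻ _u : Fin 0 → Torus d, ‖coeff a c‖ₑ ^ 4 := by simp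
    _ ≤ _ := lintegral_mono fun u => by
      rw [← e u]; exact ENNReal.le_tsum (f := fun c => ‖pcoeff _ c u‖ₑ ^ 4) c

/-! ### Passage from functions to measures -/

section Limit

variable {φ : ℕ → C(Torus d, ℝ)} (hφ : IsFrequencyCutoff φ)
include hφ

/-- A finite norm means that the weak limit exists; test it against `1` along the approximate
identity `φ`. -/
theorem tendsto_gowersInner {μ : ComplexMeasure (Torus d)} (hμ : uNorm m μ ≠ ∞) :
    Tendsto (fun n => ‖gowersInner m (fun _ => mollify (φ n) μ)‖ₑ ^ ((1 : ℝ) / 2 ^ m)) atTop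
      (𝓝 (uNorm m μ)) := by
  by_cases h : ∃ D, IsWeakValue (deltaFun m) (fun _ => μ) D
  · have hw : IsWeakValue (deltaFun m) (fun _ => μ) (weakValue (deltaFun m) fun _ => μ) := by
      rw [weakValue, dif_pos h]; exact h.choose_spec
    have ht := hw φ hφ.toIsApproxIdentity (1 : C(Cube d m, ℂ))
    simp only [ContinuousMap.one_apply, one_mul] at ht
    have e : cintegral (weakValue (deltaFun m) fun _ => μ) (1 : C(Cube d m, ℂ))
        = weakValue (deltaFun m) (fun _ => μ) Set.univ := cintegral_one _
    rw [e] at ht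
    rw [uNorm, if_pos h]
    exact (ENNReal.continuous_rpow_const.tendsto _).comp ht.enorm
  · exact absurd (by rw [uNorm, if_neg h]) hμ

/-- The norms of the mollifications tend to `0` and dominate their Fourier coefficients, which
converge to those of `μ`. So all coefficients of `μ` vanish, and each mollification is a combination
of them. -/
theorem mollify_eq_zero_of_uNorm_eq_zero {μ : ComplexMeasure (Torus d)}
    (hμ : uNorm (m + 2) μ = 0) (n : ℕ) : mollify (φ n) μ = 0 := by
  have hfin := hφ.finite_support
  have hb : ∀ n, IsBdd (mollify (φ n) μ) := fun n => isBdd_mollify (hfin n) μ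
  have h1 := tendsto_gowersInner hφ (hμ.trans_ne ENNReal.zero_ne_top)
  rw [hμ] at h1
  have h2 : Tendsto (fun n => ‖gowersInner (m + 2) (fun _ => mollify (φ n) μ)‖ₑ) atTop
      (𝓝 0) := by
    have := (ENNReal.continuous_rpow_const (y := 2 ^ (m + 2))).tendsto 0 |>.comp h1
    rw [ENNReal.zero_rpow_of_pos (by positivity)] at this
    refine this.congr fun n => ?_
    simp only [Function.comp, ← ENNReal.rpow_mul]
    rw [one_div, inv_mul_cancel₀ (by positivity), ENNReal.rpow_one]
  have hc : ∀ ξ, measureCoeff μ ξ = 0 := fun ξ => by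
    have h3 : Tendsto (fun n => coeff (mollify (φ n) μ) ξ) atTop (𝓝 (measureCoeff μ ξ)) := by
      simp only [fun n => coeff_mollify (hfin n) μ ξ]
      simpa using (tendsto_kernelCoeff hφ.toIsApproxIdentity ξ).mul_const (measureCoeff μ ξ)
    have h4 : Tendsto (fun n => (‖coeff (mollify (φ n) μ) ξ‖ₑ ^ 4) ^ 2 ^ m) atTop
        (𝓝 ((‖measureCoeff μ ξ‖ₑ ^ 4) ^ 2 ^ m)) :=
      ENNReal.Tendsto.pow (ENNReal.Tendsto.pow h3.enorm)
    have h5 := le_of_tendsto_of_tendsto' h4 h2 fun n => by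
      rw [enorm_gowersInner_const (hb n)]
      exact (pow_le_pow_left' (enorm_coeff_pow_four_le (hb n) ξ) _).trans
        (margSq_one_pow_le (hb n) m)
    simpa using h5
  funext x
  simp [mollify_eq_sum (hfin n), hc]

/-- A bound for functions passes to the weak values at complex measures. -/
theorem tsum_fourierCoeff_weakValue_le
    {G : ((Fin (k + 1) → Bool) → Torus d → ℂ) → Cube d (k + 1) → ℂ} {C : ℝ≥0∞} (hC0 : C ≠ 0)
    (hC : C ≠ ∞) (hG : ∀ f : (Fin (k + 1) → Bool) → Torus d → ℂ, (∀ ι, IsBdd (f ι)) →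
      ∑' η : Fin (k + 1) → Fin d → ℤ, ‖∫ p : Cube d (k + 1), (UnitAddTorus.mFourier (-0) p.1
        * ∏ i, UnitAddTorus.mFourier (-(η i)) (p.2 i)) * G f p‖ₑ ^ 2
      ≤ C * ∏ ι, (‖gowersInner (k + 2) (fun _ => f ι)‖ₑ ^ ((1 : ℝ) / 2 ^ (k + 2))) ^ 2)
    (μ : (Fin (k + 1) → Bool) → ComplexMeasure (Torus d)) :
    ∑' η : Fin (k + 1) → Fin d → ℤ, ‖fourierCoeffMeasure (weakValue G μ) 0 η‖ₑ ^ 2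
      ≤ C * ∏ ι, uNorm (k + 2) (μ ι) ^ 2 := by
  -- Without a weak limit the default value is the zero measure, and the left side is `0`.
  by_cases h : ∃ D, IsWeakValue G μ D
  swap
  · rw [weakValue, dif_neg h]
    simp [fourierCoeffMeasure, cintegral_zero_measure]
  have hw : IsWeakValue G μ (weakValue G μ) := by
    rw [weakValue, dif_pos h]; exact h.choose_spec
  let χ : (Fin (k + 1) → Fin d → ℤ) → C(Cube d (k + 1), ℂ) := fun η =>
    ⟨fun p => UnitAddTorus.mFourier (-0) p.1 * ∏ i, UnitAddTorus.mFourier (-(η i)) (p.2 i),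
      by fun_prop⟩
  have ht : ∀ η, Tendsto (fun n => ‖∫ p : Cube d (k + 1), (UnitAddTorus.mFourier (-0) p.1
      * ∏ i, UnitAddTorus.mFourier (-(η i)) (p.2 i)) * G (fun ι => mollify (φ n) (μ ι)) p‖ₑ ^ 2)
      atTop (𝓝 (‖fourierCoeffMeasure (weakValue G μ) 0 η‖ₑ ^ 2)) := fun η =>
    ENNReal.Tendsto.pow (hw φ hφ.toIsApproxIdentity (χ η)).enorm
  have hle := fun n => hG (fun ι => mollify (φ n) (μ ι))
    fun ι => isBdd_mollify (hφ.finite_support n) (μ ι)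
  have key : ∀ {R : ℝ≥0∞}, Tendsto (fun n => C * ∏ ι, (‖gowersInner (k + 2)
      (fun _ => mollify (φ n) (μ ι))‖ₑ ^ ((1 : ℝ) / 2 ^ (k + 2))) ^ 2) atTop (𝓝 R) →
      ∑' η : Fin (k + 1) → Fin d → ℤ, ‖fourierCoeffMeasure (weakValue G μ) 0 η‖ₑ ^ 2 ≤ R := by
    intro R hR
    -- Fatou for series: each finite partial sum passes to the limit.
    rw [ENNReal.tsum_eq_iSup_sum]
    exact iSup_le fun s => le_of_tendsto_of_tendsto' (tendsto_finsetSum s fun η _ => ht η) hR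
      fun n => (ENNReal.sum_le_tsum s).trans (hle n)
  -- This case must precede the infinite one: `0 * ∞ = 0` in `ℝ≥0∞`, so a vanishing norm demands a
  -- vanishing left side.
  by_cases h0 : ∃ ι, uNorm (k + 2) (μ ι) = 0
  · obtain ⟨ι₀, hι₀⟩ := h0
    refine (key (R := 0) ?_).trans zero_le
    refine tendsto_const_nhds.congr fun n => ?_
    rw [Finset.prod_eq_zero (Finset.mem_univ ι₀), mul_zero]
    rw [mollify_eq_zero_of_uNorm_eq_zero hφ hι₀ n, gowersInner, deltaFun_const_zero]
    simp
  by_cases htop : ∃ ι, uNorm (k + 2) (μ ι) = ∞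
  · obtain ⟨ι₁, hι₁⟩ := htop
    have : ∏ ι, uNorm (k + 2) (μ ι) ^ 2 = ∞ := by
      rw [← Finset.mul_prod_erase _ _ (Finset.mem_univ ι₁), hι₁, ENNReal.top_pow two_ne_zero,
        ENNReal.top_mul (Finset.prod_ne_zero_iff.mpr fun ι _ => pow_ne_zero 2 (h0 ⟨ι, ·⟩))]
    rw [this, ENNReal.mul_top hC0]
    exact le_top
  push Not at h0 htop
  exact key (ENNReal.Tendsto.const_mul (ENNReal.tendsto_finsetProd_of_ne_top _
    (fun ι _ => ENNReal.Tendsto.pow (tendsto_gowersInner hφ (htop ι)))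
    fun ι _ => ENNReal.pow_ne_top (htop ι)) (Or.inr hC))

end Limit

end GowersSingular

theorem mainTheorem7 {d k : ℕ} (φ : ℕ → C(GowersSingular.Torus d, ℝ))
    (hφ : GowersSingular.IsFrequencyCutoff φ) (N : ℕ) (j : Fin (k + 1))
    (μ : (Fin (k + 1) → Bool) → ComplexMeasure (GowersSingular.Torus d))
    (hμ : ∀ ι, GowersSingular.MemU (k + 1) (μ ι)) :
    (∑' η : Fin (k + 1) → Fin d → ℤ,
        ‖GowersSingular.fourierCoeffMeasure
          (GowersSingular.deltaHighBoth (φ N) j μ) 0 η‖ₑ ^ 2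
      ≤ 16 * ∏ ι, GowersSingular.uNorm (k + 2) (μ ι) ^ 2) ∧
    (∑' η : Fin (k + 1) → Fin d → ℤ,
        ‖GowersSingular.fourierCoeffMeasure
          (GowersSingular.deltaHighRight (φ N) j μ) 0 η‖ₑ ^ 2
      ≤ 2 * ∏ ι, GowersSingular.uNorm (k + 2) (μ ι) ^ 2) :=
  ⟨GowersSingular.tsum_fourierCoeff_weakValue_le hφ (by norm_num) (by norm_num)
      (fun _ hf => GowersSingular.tsum_fourier_deltaFunHighBoth_le (hφ.isCutoffKernel N) j hf) μ,
    GowersSingular.tsum_fourierCoeff_weakValue_le hφ (by norm_num) (by norm_num)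
      (fun _ hf => GowersSingular.tsum_fourier_deltaFunHighRight_le (hφ.isCutoffKernel N) j hf) μ⟩
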